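/- Let $D$ be the ribbon tree, i.e. the oriented planar surface with boundary obtained by thickening the infinite planar trivalent tree, decomposed into hexagons (one for each vertex of the tree) by arcs (one transversal to each edge of the tree), and let $D^{*}$ be $D$ with one puncture on each arc. An orientation-preserving homeomorphism $\varphi$ of $D$ (or of $D^{*}$) is asymptotically rigid if there is a finite union of hexagons $\Sigma$ such that $\varphi(\Sigma)$ is a finite union of hexagons and $\varphi$ maps the hexagons outside $\Sigma$ onto the hexagons outside $\varphi(\Sigma)$. Let $T$ (the Ptolemy–Thompson group) and $T^{*}$ (the braided Ptolemy–Thompson group) be the groups of asymptotically rigid homeomorphisms of $D$, respectively of $D^{*}$, modulo isotopy, and let $T^{*}\to T$ be the homomorphism that forgets the punctures. (Isotopies in $D$ preserve the boundary of $D$; in the definition of $T^{*}$ they may be required either to preserve the boundary or to fix it pointwise: the statement holds in both cases.) Let $\beta^{*}\in T^{*}$ be the class of the homeomorphism that rotates a central hexagon counterclockwise by a third of a turn and permutes cyclically the three branches of the ribbon tree issuing from it, and let $\alpha^{*}\in T^{*}$ be the class of the homeomorphism that rotates counterclockwise by a quarter of a turn the union of the central hexagon and one adjacent hexagon, fixing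 the puncture between the two, and permutes cyclically the four branches issuing from this union. Let $\alpha,\beta\in T$ be the images of $\alpha^{*},\beta^{*}$. Then: 1. $\alpha^{*2}$ has order $2$ and $\beta^{*}$ has order $3$ in $T^{*}$. 2. The homomorphism $T^{*}\to T$ maps the subgroup $\langle\alpha^{*2},\beta^{*}\rangle$ of $T^{*}$ isomorphically onto the subgroup $\langle\alpha^{2},\beta\rangle$ of $T$. 3. The group $PSL(2,\mathbb Z)$ is the free product $\mathbb Z/2*\mathbb Z/3$ of the subgroups generated by $S=\pm\begin{pmatrix}0&-1\\1&0\end{pmatrix}$ and $U=\pm\begin{pmatrix}0&1\\-1&1\end{pmatrix}$. There is an injective homomorphism $i:PSL(2,\mathbb Z)\to T$ with $i(S)=\alpha^{2}$, $i(U)=\beta$ and image $\langle\alpha^{2},\beta\rangle$, and it lifts to an injective homomorphism $s:PSL(2,\mathbb Z)\to T^{*}$ with $s(S)=\alpha^{*2}$, $s(U)=\beta^{*}$ and image $\langle\alpha^{*2},\beta^{*}\rangle$; that is, the composition of $s$ with $T^{*}\to T$ is $i$. -/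

import Mathlib

open scoped MatrixGroups

noncomputable section

namespace RibbonTree

/-! ### The hexagon

The model hexagon is the surface `u₀ u₁ u₂ = (1 - u₀) (1 - u₁) (1 - u₂)` in the unit cube; it is a
closed disc (it projects homeomorphically along the diagonal `(1, 1, 1)` onto a regular hexagon),
bounded by the six edges of the cube that avoid the vertices `(0,0,0)` and `(1,1,1)`.
These six edges are alternately the *arcs* `0, 1, 2` and the *boundary sides* `0, 1, 2`; the boundary
side `k` lies opposite to the arc `k`.  The orientation is the one for which the arcs `0, 1, 2` follow
each other counterclockwise.  The equation says that `u` records the ratios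
`u k = x (k+1) / (x (k+1) + x (k+2))` of barycentric coordinates `x` of a triangle whose three corners
have been blown up: the arc `k` is `x k = 0` and the boundary side `k` is `x k = 1`. -/

/-- The model hexagon. -/
abbrev Hexagon : Type :=
  {u : Fin 3 → ℝ // (∀ k, 0 ≤ u k ∧ u k ≤ 1) ∧
    u 0 * u 1 * u 2 = (1 - u 0) * (1 - u 1) * (1 - u 2)}

/-- The `k`-th arc of the hexagon, parametrized by the coordinate `u k ∈ [0, 1]`. -/
def arc (k : Fin 3) : Set Hexagon := {u | u.1 (k + 1) = 1 ∧ u.1 (k + 2) = 0}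

/-- The `k`-th boundary side of the hexagon, opposite to the `k`-th arc. -/
def side (k : Fin 3) : Set Hexagon := {u | u.1 (k + 1) = 0 ∧ u.1 (k + 2) = 1}

/-- The midpoint of the `k`-th arc. -/
def arcMid (k : Fin 3) : Set Hexagon := {u | u ∈ arc k ∧ u.1 k = 1 / 2}

/-! ### The ribbon tree -/

/-- The vertices of the infinite planar trivalent tree.  Removing the open edge
between `(false, [])`
and `(true, [])` leaves two rooted binary trees, whose vertices are the words in `false` (first child)
and `true` (second child). -/
abbrev Vertex : Type := Bool × List Bool

/-- `Adj v k w`: the arc `k` of the hexagon at `v` is glued to the arc `0` of the hexagon at `w`. -/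
inductive Adj : Vertex → Fin 3 → Vertex → Prop
  | central : Adj (false, []) 0 (true, [])
  | left (b : Bool) (l : List Bool) : Adj (b, l) 1 (b, l ++ [false])
  | right (b : Bool) (l : List Bool) : Adj (b, l) 2 (b, l ++ [true])

/-- The disjoint union of the hexagons, one for each vertex of the tree. -/
abbrev Hexagons : Type := Σ _ : Vertex, Hexagon

/-- The gluing of the hexagons along the arcs, by orientation-reversing identifications of arcs. -/
def Glue (p q : Hexagons) : Prop :=
  ∃ k, Adj p.1 k q.1 ∧ p.2 ∈ arc k ∧ q.2 ∈ arc 0 ∧ q.2.1 0 = 1 - p.2.1 k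

/-- The ribbon tree: the thickening of the infinite binary tree, with its quotient topology. -/
abbrev Surface : Type := Quot Glue

/-- The characteristic map of the hexagon at `v`. -/
def pt (v : Vertex) (u : Hexagon) : Surface := Quot.mk Glue ⟨v, u⟩

/-- The hexagon of the canonical rigid structure at the vertex `v`. -/
def hex (v : Vertex) : Set Surface := Set.range (pt v)

/-- The `k`-th arc of the hexagon at `v`, as a subset of the ribbon tree. -/
def hexArc (v : Vertex) (k : Fin 3) : Set Surface := pt v '' arc k

/-- The boundary of the ribbon tree. -/
def bdry : Set Surface := ⋃ (v : Vertex) (k : Fin 3), pt v '' side k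

/-- The punctures: the midpoints of all arcs, one for each edge of the tree. -/
def punctures : Set Surface := ⋃ (v : Vertex) (k : Fin 3), pt v '' arcMid k

/-! ### Asymptotically rigid homeomorphisms -/

/-- The union of the hexagons at the vertices in `A`; it is an admissible subsurface when `A` is
finite. -/
def region (A : Set Vertex) : Set Surface := ⋃ v ∈ A, hex v

/-- `φ` maps the admissible subsurface with hexagons `A` onto the one with hexagons `B`, and
outside of them it is rigid and orientation-preserving: it maps the hexagons bijectively onto
hexagons, taking the three arcs of each to the three arcs of its image in the same
(counterclockwise) cyclic order. -/
structure IsSupport (φ : Surface ≃ₜ Surface) (A B : Set Vertex) (e : Vertex → Vertex) : Prop where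
  finite_source : A.Finite
  finite_target : B.Finite
  image_region : φ '' region A = region B
  bijOn : Set.BijOn e Aᶜ Bᶜ
  rigid : ∀ v ∉ A, φ '' hex v = hex (e v) ∧
    ∃ k : Fin 3, ∀ j : Fin 3, φ '' hexArc v j = hexArc (e v) (j + k)

/-- The orientation-preserving homeomorphisms that are rigid outside a compact admissible
subsurface.  (Being orientation-preserving can be read off from any one hexagon outside of it.) -/
def IsAsymptoticallyRigid (φ : Surface ≃ₜ Surface) : Prop :=
  ∃ A B e, IsSupport φ A B e

/-- Homeomorphisms of the ribbon tree, as a surface with boundary, that preserve the set `P` of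
marked points; for `P = punctures` these are the homeomorphisms of the punctured ribbon tree. -/
def PreservesMarking (P : Set Surface) (φ : Surface ≃ₜ Surface) : Prop :=
  φ '' bdry = bdry ∧ φ '' P = P

lemma PreservesMarking.one (P : Set Surface) : PreservesMarking P 1 := by
  constructor <;> exact Set.image_id _

lemma PreservesMarking.mul {P : Set Surface} {φ ψ : Surface ≃ₜ Surface}
    (hφ : PreservesMarking P φ) (hψ : PreservesMarking P ψ) : PreservesMarking P (φ * ψ) := by
  constructor
  · change (fun x => φ (ψ x)) '' _ = _
    rw [← Set.image_image φ ψ, hψ.1, hφ.1]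
  · change (fun x => φ (ψ x)) '' _ = _
    rw [← Set.image_image φ ψ, hψ.2, hφ.2]

lemma image_inv_eq {φ : Surface ≃ₜ Surface} {s t : Set Surface} (h : φ '' s = t) :
    (φ⁻¹ : Surface ≃ₜ Surface) '' t = s := by
  rw [← h, Set.image_image]
  change (fun x => φ.symm (φ x)) '' s = s
  simp

lemma PreservesMarking.inv {P : Set Surface} {φ : Surface ≃ₜ Surface}
    (hφ : PreservesMarking P φ) : PreservesMarking P φ⁻¹ :=
  ⟨image_inv_eq hφ.1, image_inv_eq hφ.2⟩

lemma region_union (A B : Set Vertex) : region (A ∪ B) = region A ∪ region B :=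
  Set.biUnion_union _ _ _

lemma IsSupport.enlarge {φ : Surface ≃ₜ Surface} {A B : Set Vertex} {e : Vertex → Vertex}
    (h : IsSupport φ A B e) {C : Set Vertex} (hC : C.Finite) (hCA : C ⊆ Aᶜ) :
    IsSupport φ (A ∪ C) (B ∪ e '' C) e where
  finite_source := h.finite_source.union hC
  finite_target := h.finite_target.union (hC.image e)
  image_region := by
    rw [region_union, region_union, Set.image_union, h.image_region]
    congr 1
    simp only [region, Set.image_iUnion, Set.biUnion_image]
    exact Set.iUnion₂_congr fun v hv => (h.rigid v (hCA hv)).1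
  bijOn := by
    have h1 : (A ∪ C)ᶜ = Aᶜ \ C := by rw [Set.compl_union]; rfl
    have h2 : (B ∪ e '' C)ᶜ = Bᶜ \ e '' C := by rw [Set.compl_union]; rfl
    rw [h1, h2]
    refine ⟨?_, h.bijOn.injOn.mono Set.sdiff_subset, ?_⟩
    · rintro v ⟨hv, hvC⟩
      refine ⟨h.bijOn.mapsTo hv, ?_⟩
      rintro ⟨w, hw, hwv⟩
      exact hvC (h.bijOn.injOn (hCA hw) hv hwv ▸ hw)
    · rintro w ⟨hw, hwC⟩
      obtain ⟨v, hv, rfl⟩ := h.bijOn.surjOn hw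
      exact ⟨v, ⟨hv, fun hvC => hwC ⟨v, hvC, rfl⟩⟩, rfl⟩
  rigid v hv := h.rigid v fun hA => hv (Or.inl hA)

/-- The source of a support can be enlarged so that its target contains a given finite set. -/
lemma IsSupport.enlarge_target {φ : Surface ≃ₜ Surface} {A B : Set Vertex} {e : Vertex → Vertex}
    (h : IsSupport φ A B e) {C : Set Vertex} (hC : C.Finite) :
    ∃ A', IsSupport φ A' (B ∪ C) e := by
  have hb : Set.BijOn e (Aᶜ ∩ e ⁻¹' C) (Bᶜ ∩ C) := by
    refine ⟨fun v hv => ⟨h.bijOn.mapsTo hv.1, hv.2⟩,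
      h.bijOn.injOn.mono Set.inter_subset_left, ?_⟩
    rintro w ⟨hw, hwC⟩
    obtain ⟨v, hv, rfl⟩ := h.bijOn.surjOn hw
    exact ⟨v, ⟨hv, hwC⟩, rfl⟩
  have hfin : (Aᶜ ∩ e ⁻¹' C).Finite := by
    refine Set.Finite.of_finite_image ?_ hb.injOn
    rw [hb.image_eq]
    exact hC.inter_of_right _
  have := h.enlarge hfin Set.inter_subset_left
  rw [hb.image_eq] at this
  have e1 : B ∪ Bᶜ ∩ C = B ∪ C := by
    ext x; by_cases hx : x ∈ B <;> simp [hx]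
  rw [e1] at this
  exact ⟨_, this⟩

lemma IsAsymptoticallyRigid.one : IsAsymptoticallyRigid 1 := by
  refine ⟨∅, ∅, id, Set.finite_empty, Set.finite_empty, ?_, Set.bijOn_id _, ?_⟩
  · exact Set.image_id _
  · intro v _
    exact ⟨Set.image_id _, 0, fun j => by rw [add_zero]; exact Set.image_id _⟩

lemma IsSupport.mul {φ ψ : Surface ≃ₜ Surface} {A B C : Set Vertex} {e f : Vertex → Vertex}
    (hφ : IsSupport φ B C f) (hψ : IsSupport ψ A B e) : IsSupport (φ * ψ) A C (f ∘ e) where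
  finite_source := hψ.finite_source
  finite_target := hφ.finite_target
  image_region := by
    change (fun x => φ (ψ x)) '' _ = _
    rw [← Set.image_image φ ψ, hψ.image_region, hφ.image_region]
  bijOn := hφ.bijOn.comp hψ.bijOn
  rigid v hv := by
    obtain ⟨h1, k, hk⟩ := hψ.rigid v hv
    obtain ⟨h2, l, hl⟩ := hφ.rigid (e v) (hψ.bijOn.mapsTo hv)
    constructor
    · change (fun x => φ (ψ x)) '' _ = _
      rw [← Set.image_image φ ψ, h1, h2]; rfl
    · refine ⟨k + l, fun j => ?_⟩
      change (fun x => φ (ψ x)) '' _ = _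
      rw [← Set.image_image φ ψ, hk, hl, add_assoc]; rfl

lemma IsAsymptoticallyRigid.mul {φ ψ : Surface ≃ₜ Surface}
    (hφ : IsAsymptoticallyRigid φ) (hψ : IsAsymptoticallyRigid ψ) :
    IsAsymptoticallyRigid (φ * ψ) := by
  obtain ⟨A, B, e, h⟩ := hψ
  obtain ⟨C, D, f, g⟩ := hφ
  obtain ⟨A', h'⟩ := h.enlarge_target (g.finite_source.sdiff (t := B))
  have g' := g.enlarge (h.finite_target.sdiff (t := C)) fun v hv => hv.2
  rw [Set.union_sdiff_self] at h' g'
  rw [Set.union_comm C B] at g'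
  exact ⟨_, _, _, g'.mul h'⟩

lemma IsAsymptoticallyRigid.inv {φ : Surface ≃ₜ Surface}
    (hφ : IsAsymptoticallyRigid φ) : IsAsymptoticallyRigid φ⁻¹ := by
  obtain ⟨A, B, e, h⟩ := hφ
  have hinv := h.bijOn.invOn_invFunOn
  have hb : Set.BijOn (Function.invFunOn e Aᶜ) Bᶜ Aᶜ := h.bijOn.symm hinv.symm
  refine ⟨B, A, Function.invFunOn e Aᶜ, h.finite_target, h.finite_source,
    image_inv_eq h.image_region, hb, ?_⟩
  intro w hw
  obtain ⟨h1, k, hk⟩ := h.rigid _ (hb.mapsTo hw)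
  rw [hinv.2 hw] at h1
  refine ⟨image_inv_eq h1, -k, fun j => ?_⟩
  apply image_inv_eq
  rw [hk, hinv.2 hw, neg_add_cancel_right]

/-- The group of asymptotically rigid homeomorphisms preserving the set `P` of marked points. -/
def rigidHomeo (P : Set Surface) : Subgroup (Surface ≃ₜ Surface) where
  carrier := {φ | PreservesMarking P φ ∧ IsAsymptoticallyRigid φ}
  mul_mem' ha hb := ⟨ha.1.mul hb.1, ha.2.mul hb.2⟩
  one_mem' := ⟨.one P, .one⟩
  inv_mem' ha := ⟨ha.1.inv, ha.2.inv⟩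

/-! ### Isotopies and mapping classes -/

/-- `φ` is isotopic to the identity through homeomorphisms of the ribbon tree that preserve the set
`P` of marked points; if `rel` holds, these are required to fix the boundary pointwise. -/
def IsotopicToId (P : Set Surface) (rel : Prop) (φ : Surface ≃ₜ Surface) : Prop :=
  ∃ H : unitInterval × Surface → Surface, Continuous H ∧
    (∀ t, ∃ ψ : Surface ≃ₜ Surface, PreservesMarking P ψ ∧ ∀ x, H (t, x) = ψ x) ∧
    (∀ x, H (0, x) = x) ∧ (∀ x, H (1, x) = φ x) ∧
    (rel → ∀ t, ∀ x ∈ bdry, H (t, x) = x)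

/-- The asymptotically rigid homeomorphisms that are isotopic to the identity; two asymptotically
rigid homeomorphisms are isotopic when they are in the same coset. -/
def isotopyTrivial (P : Set Surface) (rel : Prop) : Subgroup (rigidHomeo P) where
  carrier := {φ | IsotopicToId P rel φ.1}
  one_mem' := ⟨fun p => p.2, continuous_snd, fun _ => ⟨1, .one P, fun _ => rfl⟩, fun _ => rfl,
    fun _ => rfl, fun _ _ _ _ => rfl⟩
  mul_mem' := by
    rintro φ ψ ⟨H, hH, hH1, hH0, hHφ, hHr⟩ ⟨K, hK, hK1, hK0, hKψ, hKr⟩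
    refine ⟨fun p => H (p.1, K p), hH.comp (continuous_fst.prodMk hK), fun t => ?_, fun x => ?_,
      fun x => ?_, fun hr t x hx => ?_⟩
    · obtain ⟨f, hf, hf'⟩ := hH1 t
      obtain ⟨g, hg, hg'⟩ := hK1 t
      exact ⟨f * g, hf.mul hg, fun x => by simp [hf', hg']⟩
    · simp [hH0, hK0]
    · simp [hHφ, hKψ]
    · simp [hKr hr t x hx, hHr hr t x hx]
  inv_mem' := by
    rintro φ ⟨H, hH, hH1, hH0, hHφ, hHr⟩
    refine ⟨fun p => φ.1.symm (H (unitInterval.symm p.1, p.2)), ?_, fun t => ?_, fun x => ?_,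
      fun x => ?_, fun hr t x hx => ?_⟩
    · exact φ.1.symm.continuous.comp (hH.comp
        ((unitInterval.continuous_symm.comp continuous_fst).prodMk continuous_snd))
    · obtain ⟨f, hf, hf'⟩ := hH1 (unitInterval.symm t)
      exact ⟨φ.1⁻¹ * f, φ.2.1.inv.mul hf, fun x => by simp [hf']⟩
    · simp [hHφ]
    · simp only [unitInterval.symm_one, hH0]; rfl
    · have : φ.1 x = x := by rw [← hHφ, hHr hr 1 x hx]
      simp only [hHr hr _ x hx]
      rw [Homeomorph.symm_apply_eq, this]

instance (P : Set Surface) (rel : Prop) : (isotopyTrivial P rel).Normal where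
  conj_mem := by
    rintro φ ⟨H, hH, hH1, hH0, hHφ, hHr⟩ g
    refine ⟨fun p => g.1 (H (p.1, g.1.symm p.2)), ?_, fun t => ?_, fun x => ?_,
      fun x => ?_, fun hr t x hx => ?_⟩
    · exact g.1.continuous.comp (hH.comp
        (continuous_fst.prodMk (g.1.symm.continuous.comp continuous_snd)))
    · obtain ⟨f, hf, hf'⟩ := hH1 t
      exact ⟨g.1 * f * g.1⁻¹, (g.2.1.mul hf).mul g.2.1.inv, fun x => by simp [hf']⟩
    · simp [hH0]
    · simp only [hHφ]; rfl
    · have : g.1.symm x ∈ bdry := by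
        rw [← g.2.1.inv.1]
        exact Set.mem_image_of_mem _ hx
      simp only [hHr hr t _ this, Homeomorph.apply_symm_apply]

/-- The asymptotic mapping class group of the ribbon tree with marked points `P`: asymptotically
rigid homeomorphisms modulo isotopy. -/
abbrev MappingClassGroup (P : Set Surface) (rel : Prop) : Type :=
  rigidHomeo P ⧸ isotopyTrivial P rel

/-- The Ptolemy-Thompson group `T`, as the group of asymptotically rigid homeomorphisms of the
ribbon tree modulo isotopy. -/
abbrev T : Type := MappingClassGroup ∅ False

/-- The braided Ptolemy-Thompson group `T*`: asymptotically rigid homeomorphisms of the punctured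
ribbon tree modulo isotopy, where isotopies fix the boundary pointwise if `rel` holds, and are only
required to preserve it if `rel` fails. -/
abbrev TStar (rel : Prop) : Type := MappingClassGroup punctures rel

lemma rigidHomeo_le (P : Set Surface) : rigidHomeo P ≤ rigidHomeo ∅ :=
  fun _ h => ⟨⟨h.1.1, Set.image_empty _⟩, h.2⟩

/-- The homomorphism `T* → T` that forgets the punctures. -/
def forget (rel : Prop) : TStar rel →* T :=
  QuotientGroup.map _ _ (Subgroup.inclusion (rigidHomeo_le punctures)) <| by
    rintro φ ⟨H, hH, hH1, hH0, hHφ, _⟩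
    refine ⟨H, hH, fun t => ?_, hH0, hHφ, False.elim⟩
    obtain ⟨f, hf, hf'⟩ := hH1 t
    exact ⟨f, ⟨hf.1, Set.image_empty _⟩, hf'⟩

/-! ### The rotation `β` of order three -/

/-- The rotation of the hexagon that takes the arc `k` to the arc `k + 1`. -/
def hexRot (u : Hexagon) : Hexagon :=
  ⟨fun k => u.1 (k - 1), fun k => u.2.1 _, by
    have := u.2.2
    have h0 : (0 : Fin 3) - 1 = 2 := rfl
    have h1 : (1 : Fin 3) - 1 = 0 := rfl
    have h2 : (2 : Fin 3) - 1 = 1 := rfl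
    simp only [h0, h1, h2]; linarith⟩

/-- The rotation of the tree about the vertex `(false, [])`. -/
def betaVertex : Vertex → Vertex
  | (false, []) => (false, [])
  | (true, l) => (false, false :: l)
  | (false, false :: l) => (false, true :: l)
  | (false, true :: l) => (true, l)

/-- `β` rotates the central hexagon, at `(false, [])`, and permutes cyclically the three branches of
the ribbon tree issuing from it. -/
def betaPre (p : Hexagons) : Hexagons :=
  ⟨betaVertex p.1, if p.1 = (false, []) then hexRot p.2 else p.2⟩

/-! ### The rotation `α` of order four -/

/-- The coordinate formula of `α` on the half `u 0 ≤ 1 / 2` of a hexagon, which stays in it. In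
the barycentric coordinates `x` it is `(x₀, x₁, x₂) ↦ (x₂ - x₁, x₀ + x₁, x₁)`. -/
def stay (u : Hexagon) (h : u.1 0 ≤ 1 / 2) : Hexagon :=
  ⟨![1 / (2 - u.1 2), u.1 0 / (1 - u.1 0), u.1 1 * (1 - 2 * u.1 0) / (1 - u.1 0)], by
    obtain ⟨hu, he⟩ := u.2
    have h0 := hu 0
    have h1 := hu 1
    have h2 := hu 2
    have p0 : 0 < 1 - u.1 0 := by linarith
    have p2 : 0 < 2 - u.1 2 := by linarith
    refine ⟨?_, ?_⟩
    · simp only [Fin.forall_fin_succ]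
      simp
      refine ⟨⟨by linarith, ?_⟩, ⟨?_, ?_⟩, ?_, ?_⟩
      · rw [inv_le_one₀ p2]; linarith
      · exact div_nonneg h0.1 p0.le
      · rw [div_le_one p0]; linarith
      · exact div_nonneg (mul_nonneg h1.1 (by linarith)) p0.le
      · rw [div_le_one p0]; nlinarith
    · simp
      field_simp
      linear_combination (1 - 2 * u.1 0) * he⟩

/-- The coordinate formula of `α` on the half `1 / 2 ≤ u 0` of a hexagon, which is moved to the
adjacent hexagon. In the barycentric coordinates `x` it is
`(x₀, x₁, x₂) ↦ (x₁ - x₂, x₂, x₂ + x₀)`. -/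
def cross (u : Hexagon) (h : 1 / 2 ≤ u.1 0) : Hexagon :=
  ⟨![u.1 1 / (1 + u.1 1), u.1 2 + (1 - u.1 2) * (1 - u.1 0) / u.1 0, (2 * u.1 0 - 1) / u.1 0], by
    obtain ⟨hu, he⟩ := u.2
    have h0 := hu 0
    have h1 := hu 1
    have h2 := hu 2
    have p0 : 0 < u.1 0 := by linarith
    have p1 : 0 < 1 + u.1 1 := by linarith
    refine ⟨?_, ?_⟩
    · simp only [Fin.forall_fin_succ]
      simp
      refine ⟨⟨?_, ?_⟩, ⟨?_, ?_⟩, ?_, ?_⟩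
      · exact div_nonneg h1.1 p1.le
      · rw [div_le_one p1]; linarith
      · have := div_nonneg (mul_nonneg (sub_nonneg.2 h2.2) (sub_nonneg.2 h0.2)) p0.le
        linarith
      · have : (1 - u.1 2) * (1 - u.1 0) / u.1 0 ≤ 1 - u.1 2 := by
          rw [div_le_iff₀ p0]; nlinarith
        linarith
      · exact div_nonneg (by linarith) p0.le
      · rw [div_le_one p0]; linarith
    · simp
      field_simp
      linear_combination (2 * u.1 0 - 1) * he⟩

/-- `α` rotates by a quarter of a full turn the union of the two hexagons at `(false, [])` and
`(true, [])`, fixing the puncture between them, and permutes cyclically the four branches of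
the ribbon tree issuing from that union. -/
def alphaPre : Hexagons → Surface
  | ⟨(b, []), u⟩ =>
      if h : u.1 0 ≤ 1 / 2 then pt (b, []) (stay u h) else pt (!b, []) (cross u (le_of_not_ge h))
  | ⟨(b, false :: l), u⟩ => pt (b, true :: l) u
  | ⟨(b, true :: l), u⟩ => pt (!b, false :: l) u

lemma pt_eq {v w : Vertex} {k : Fin 3} (h : Adj v k w) {u u' : Hexagon} (hu : u ∈ arc k)
    (hu' : u' ∈ arc 0) (he : u'.1 0 = 1 - u.1 k) : pt v u = pt w u' :=
  Quot.sound ⟨k, h, hu, hu', he⟩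

lemma pt_central (b : Bool) {u u' : Hexagon} (hu : u ∈ arc 0) (hu' : u' ∈ arc 0)
    (he : u'.1 0 = 1 - u.1 0) : pt (b, []) u = pt (!b, []) u' := by
  cases b
  · exact pt_eq .central hu hu' he
  · exact (pt_eq .central hu' hu (by linarith)).symm

lemma hexagon_ext {u v : Hexagon} (h0 : u.1 0 = v.1 0) (h1 : u.1 1 = v.1 1)
    (h2 : u.1 2 = v.1 2) : u = v := by
  apply Subtype.ext
  funext k
  fin_cases k
  exacts [h0, h1, h2]

lemma mem_arc_zero {u : Hexagon} : u ∈ arc 0 ↔ u.1 1 = 1 ∧ u.1 2 = 0 := Iff.rfl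

lemma mem_arc_one {u : Hexagon} : u ∈ arc 1 ↔ u.1 2 = 1 ∧ u.1 0 = 0 := Iff.rfl

lemma mem_arc_two {u : Hexagon} : u ∈ arc 2 ↔ u.1 0 = 1 ∧ u.1 1 = 0 := Iff.rfl

lemma mem_side_zero {u : Hexagon} : u ∈ side 0 ↔ u.1 1 = 0 ∧ u.1 2 = 1 := Iff.rfl

lemma mem_side_one {u : Hexagon} : u ∈ side 1 ↔ u.1 2 = 0 ∧ u.1 0 = 1 := Iff.rfl

lemma mem_side_two {u : Hexagon} : u ∈ side 2 ↔ u.1 0 = 0 ∧ u.1 1 = 1 := Iff.rfl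

lemma stay_zero (u : Hexagon) (h) : (stay u h).1 0 = 1 / (2 - u.1 2) := rfl
lemma stay_one (u : Hexagon) (h) : (stay u h).1 1 = u.1 0 / (1 - u.1 0) := rfl
lemma stay_two (u : Hexagon) (h) :
    (stay u h).1 2 = u.1 1 * (1 - 2 * u.1 0) / (1 - u.1 0) := rfl
lemma cross_zero (u : Hexagon) (h) : (cross u h).1 0 = u.1 1 / (1 + u.1 1) := rfl
lemma cross_one (u : Hexagon) (h) :
    (cross u h).1 1 = u.1 2 + (1 - u.1 2) * (1 - u.1 0) / u.1 0 := rfl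
lemma cross_two (u : Hexagon) (h) : (cross u h).1 2 = (2 * u.1 0 - 1) / u.1 0 := rfl

lemma seam (b : Bool) (u : Hexagon) (h : u.1 0 = 1 / 2) :
    pt (b, []) (stay u h.le) = pt (!b, []) (cross u h.ge) := by
  have he := u.2.2
  have h1 := u.2.1 1
  have h2 := u.2.1 2
  rw [h] at he
  apply pt_central
  · rw [mem_arc_zero, stay_one, stay_two, h]; norm_num
  · rw [mem_arc_zero, cross_one, cross_two, h]; norm_num
  · rw [cross_zero, stay_zero]
    have e : u.1 2 = 1 - u.1 1 := by linarith
    have p : 0 < 1 + u.1 1 := by linarith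
    rw [e, show 2 - (1 - u.1 1) = 1 + u.1 1 by ring]
    field_simp
    ring

lemma alphaPre_stay (b : Bool) (u : Hexagon) (h : u.1 0 ≤ 1 / 2) :
    alphaPre ⟨(b, []), u⟩ = pt (b, []) (stay u h) := dif_pos h

lemma alphaPre_cross (b : Bool) (u : Hexagon) (h : 1 / 2 ≤ u.1 0) :
    alphaPre ⟨(b, []), u⟩ = pt (!b, []) (cross u h) := by
  by_cases h' : u.1 0 ≤ 1 / 2
  · rw [alphaPre_stay b u h', seam b u (le_antisymm h' h)]
  · exact dif_neg h'

lemma stay_eq_cross {u u' : Hexagon} (hu : u ∈ arc 0) (hu' : u' ∈ arc 0)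
    (he : u'.1 0 = 1 - u.1 0) (h : u.1 0 ≤ 1 / 2) (h' : 1 / 2 ≤ u'.1 0) :
    stay u h = cross u' h' := by
  rw [mem_arc_zero] at hu hu'
  have p : 0 < 1 - u.1 0 := by linarith
  apply hexagon_ext
  · rw [stay_zero, cross_zero, hu.2, hu'.1]; norm_num
  · rw [stay_one, cross_one, hu'.2, he]; field_simp; ring
  · rw [stay_two, cross_two, hu.1, he]; congr 1; ring

lemma alphaPre_glue (p q : Hexagons) (h : Glue p q) : alphaPre p = alphaPre q := by
  obtain ⟨⟨b, l⟩, u⟩ := p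
  obtain ⟨⟨b', l'⟩, u'⟩ := q
  obtain ⟨k, ha, hu, hu', he⟩ := h
  simp only at ha hu hu' he
  cases ha with
  | central =>
    rcases le_total (u.1 0) (1 / 2) with h | h
    · rw [alphaPre_stay _ _ h, alphaPre_cross _ u' (by linarith)]
      exact congrArg _ (stay_eq_cross hu hu' he _ _)
    · rw [alphaPre_cross _ _ h, alphaPre_stay _ u' (by linarith)]
      exact congrArg _ (stay_eq_cross hu' hu (by linarith) _ _).symm
  | left =>
    match l with
    | [] =>
      have h := mem_arc_one.1 hu
      have h0 : u.1 0 ≤ 1 / 2 := by rw [h.2]; norm_num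
      rw [alphaPre_stay _ _ h0]
      refine pt_eq (.right b []) ?_ hu' ?_
      · rw [mem_arc_two, stay_zero, stay_one, h.1, h.2]; norm_num
      · rw [he, stay_two, h.2]; norm_num
    | false :: l => exact pt_eq (.left b (true :: l)) hu hu' he
    | true :: l => exact pt_eq (.left (!b) (false :: l)) hu hu' he
  | right =>
    match l with
    | [] =>
      have h := mem_arc_two.1 hu
      have h0 : 1 / 2 ≤ u.1 0 := by rw [h.1]; norm_num
      rw [alphaPre_cross _ _ h0]
      refine pt_eq (.left (!b) []) ?_ hu' ?_
      · rw [mem_arc_one, cross_zero, cross_two, h.1, h.2]; norm_num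
      · rw [he, cross_one, h.1]; norm_num
    | false :: l => exact pt_eq (.right b (true :: l)) hu hu' he
    | true :: l => exact pt_eq (.right (!b) (false :: l)) hu hu' he

/-- `α` as a map of the ribbon tree. -/
def alphaFun : Surface → Surface := Quot.lift alphaPre alphaPre_glue

/-- The half-turn of the ribbon tree about the central puncture. -/
def halfTurn : Surface → Surface :=
  Quot.lift (fun p => pt (!p.1.1, p.1.2) p.2) <| by
    rintro ⟨⟨b, l⟩, u⟩ ⟨⟨b', l'⟩, u'⟩ ⟨k, ha, hu, hu', he⟩
    simp only at ha hu hu' he ⊢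
    cases ha with
    | central => exact pt_central true hu hu' he
    | left => exact pt_eq (.left _ _) hu hu' he
    | right => exact pt_eq (.right _ _) hu hu' he

lemma surface_ind {p : Surface → Prop} (h : ∀ b l u, p (pt (b, l) u)) (x : Surface) : p x := by
  obtain ⟨⟨⟨b, l⟩, u⟩, rfl⟩ := Quot.exists_rep x
  exact h b l u

lemma alphaFun_alphaFun (x : Surface) : alphaFun (alphaFun x) = halfTurn x := by
  induction x using surface_ind with
  | h b l u =>
    match l with
    | false :: l => rfl
    | true :: l => rfl
    | [] =>
      change alphaFun (alphaPre ⟨(b, []), u⟩) = pt (!b, []) u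
      obtain ⟨hu, he⟩ := u.2
      have h0 := hu 0
      have h1 := hu 1
      have h2 := hu 2
      rcases le_total (u.1 0) (1 / 2) with h | h
      · have p0 : 0 < 1 - u.1 0 := by linarith
        have p2 : 0 < 2 - u.1 2 := by linarith
        have h' : 1 / 2 ≤ (stay u h).1 0 := by
          rw [stay_zero]; exact one_div_le_one_div_of_le p2 (by linarith)
        rw [alphaPre_stay _ _ h]
        refine (alphaPre_cross b _ h').trans (congrArg _ (hexagon_ext ?_ ?_ ?_))
        · rw [cross_zero, stay_one]; field_simp; ring
        · rw [cross_one, stay_two, stay_zero]; field_simp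
          linear_combination (-1) * he
        · rw [cross_two, stay_zero]; field_simp; ring
      · have p0 : 0 < u.1 0 := by linarith
        have p1 : 0 < 1 + u.1 1 := by linarith
        have h' : (cross u h).1 0 ≤ 1 / 2 := by
          rw [cross_zero, div_le_div_iff₀ p1 two_pos]; linarith
        rw [alphaPre_cross _ _ h]
        refine (alphaPre_stay (!b) _ h').trans (congrArg _ (hexagon_ext ?_ ?_ ?_))
        · rw [stay_zero, cross_two]; field_simp; ring
        · rw [stay_one, cross_zero]; field_simp; ring
        · rw [stay_two, cross_one, cross_zero]; field_simp
          linear_combination (-1) * he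

lemma alphaFun_pow_four (x : Surface) :
    alphaFun (alphaFun (alphaFun (alphaFun x))) = x := by
  rw [alphaFun_alphaFun, alphaFun_alphaFun]
  induction x using surface_ind with
  | h b l u => change pt (!!b, l) u = _; rw [Bool.not_not]

lemma continuous_pt (v : Vertex) : Continuous (pt v) :=
  continuous_quot_mk.comp continuous_sigmaMk

lemma continuous_alphaFun : Continuous alphaFun := by
  refine continuous_quot_lift alphaPre_glue (continuous_sigma ?_)
  rintro ⟨b, _ | ⟨_ | _, l⟩⟩
  · have hc (k : Fin 3) : Continuous fun u : Hexagon => u.1 k :=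
      (continuous_apply k).comp continuous_subtype_val
    rw [← continuousOn_univ, show (Set.univ : Set Hexagon) =
      {u | u.1 0 ≤ 1 / 2} ∪ {u | 1 / 2 ≤ u.1 0} by
        ext u; simpa using le_total _ _]
    refine ContinuousOn.union_of_isClosed ?_ ?_ (isClosed_le (hc 0) continuous_const)
      (isClosed_le continuous_const (hc 0))
    · rw [continuousOn_iff_continuous_domRestrict]
      have : Continuous fun u : {u : Hexagon | u.1 0 ≤ 1 / 2} => stay u.1 u.2 := by
        refine Continuous.subtype_mk (continuous_pi fun k => ?_) _
        have hc' (k : Fin 3) := (hc k).comp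
          (continuous_subtype_val : Continuous (Subtype.val : {u : Hexagon | u.1 0 ≤ 1 / 2} → _))
        have p0 (u : {u : Hexagon | u.1 0 ≤ 1 / 2}) : 1 - u.1.1 0 ≠ 0 := by
          have : u.1.1 0 ≤ 1 / 2 := u.2
          linarith
        have p2 (u : {u : Hexagon | u.1 0 ≤ 1 / 2}) : 2 - u.1.1 2 ≠ 0 := by
          linarith [u.1.2.1 2]
        fin_cases k
        · exact continuous_const.div (continuous_const.sub (hc' 2)) p2
        · exact (hc' 0).div (continuous_const.sub (hc' 0)) p0
        · exact ((hc' 1).mul (continuous_const.sub (continuous_const.mul (hc' 0)))).div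
            (continuous_const.sub (hc' 0)) p0
      refine ((continuous_pt (b, [])).comp this).congr fun u => ?_
      exact (alphaPre_stay b u.1 u.2).symm
    · rw [continuousOn_iff_continuous_domRestrict]
      have : Continuous fun u : {u : Hexagon | 1 / 2 ≤ u.1 0} => cross u.1 u.2 := by
        refine Continuous.subtype_mk (continuous_pi fun k => ?_) _
        have hc' (k : Fin 3) := (hc k).comp
          (continuous_subtype_val : Continuous (Subtype.val : {u : Hexagon | 1 / 2 ≤ u.1 0} → _))
        have p0 (u : {u : Hexagon | 1 / 2 ≤ u.1 0}) : u.1.1 0 ≠ 0 := by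
          have : 1 / 2 ≤ u.1.1 0 := u.2
          linarith
        have p1 (u : {u : Hexagon | 1 / 2 ≤ u.1 0}) : 1 + u.1.1 1 ≠ 0 := by
          linarith [u.1.2.1 1]
        fin_cases k
        · exact (hc' 1).div (continuous_const.add (hc' 1)) p1
        · exact (hc' 2).add (((continuous_const.sub (hc' 2)).mul
            (continuous_const.sub (hc' 0))).div (hc' 0) p0)
        · exact ((continuous_const.mul (hc' 0)).sub continuous_const).div (hc' 0) p0
      refine ((continuous_pt (!b, [])).comp this).congr fun u => ?_
      exact (alphaPre_cross b u.1 u.2).symm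
  · exact continuous_pt _
  · exact continuous_pt _

/-- The homeomorphism `α` of the ribbon tree. -/
def alphaHomeo : Surface ≃ₜ Surface where
  toFun := alphaFun
  invFun x := alphaFun (alphaFun (alphaFun x))
  left_inv := alphaFun_pow_four
  right_inv := alphaFun_pow_four
  continuous_toFun := continuous_alphaFun
  continuous_invFun :=
    continuous_alphaFun.comp (continuous_alphaFun.comp continuous_alphaFun)

lemma image_alpha {s : Set Surface} (h : Set.MapsTo alphaFun s s) : alphaHomeo '' s = s :=
  Set.Subset.antisymm h.image_subset fun x hx =>
    ⟨_, h (h (h hx)), alphaFun_pow_four x⟩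

lemma mem_bdry {v : Vertex} {k : Fin 3} {u : Hexagon} (h : u ∈ side k) : pt v u ∈ bdry :=
  Set.mem_iUnion₂.2 ⟨v, k, u, h, rfl⟩

lemma mem_punctures {v : Vertex} {k : Fin 3} {u : Hexagon} (h : u ∈ arc k)
    (h' : u.1 k = 1 / 2) : pt v u ∈ punctures :=
  Set.mem_iUnion₂.2 ⟨v, k, u, ⟨h, h'⟩, rfl⟩

lemma mapsTo_alpha_bdry : Set.MapsTo alphaFun bdry bdry := by
  intro x hx
  obtain ⟨⟨b, l⟩, k, u, hu, rfl⟩ := Set.mem_iUnion₂.1 hx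
  match l with
  | false :: l => exact mem_bdry hu
  | true :: l => exact mem_bdry hu
  | [] =>
    change alphaPre ⟨(b, []), u⟩ ∈ bdry
    match k with
    | 0 =>
      have h := mem_side_zero.1 hu
      rcases le_total (u.1 0) (1 / 2) with h0 | h0
      · rw [alphaPre_stay _ _ h0]
        refine mem_bdry (k := 1) (mem_side_one.2 ?_)
        rw [stay_two, stay_zero, h.1, h.2]; norm_num
      · rw [alphaPre_cross _ _ h0]
        refine mem_bdry (k := 2) (mem_side_two.2 ?_)
        rw [cross_zero, cross_one, h.1, h.2]; norm_num
    | 1 =>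
      have h := mem_side_one.1 hu
      have h0 : 1 / 2 ≤ u.1 0 := by rw [h.2]; norm_num
      rw [alphaPre_cross _ _ h0]
      refine mem_bdry (k := 0) (mem_side_zero.2 ?_)
      rw [cross_one, cross_two, h.1, h.2]; norm_num
    | 2 =>
      have h := mem_side_two.1 hu
      have h0 : u.1 0 ≤ 1 / 2 := by rw [h.1]; norm_num
      rw [alphaPre_stay _ _ h0]
      refine mem_bdry (k := 0) (mem_side_zero.2 ?_)
      rw [stay_one, stay_two, h.1, h.2]
      have := u.2.2
      rw [h.1, h.2] at this
      norm_num

lemma mapsTo_alpha_punctures : Set.MapsTo alphaFun punctures punctures := by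
  intro x hx
  obtain ⟨⟨b, l⟩, k, u, ⟨hu, hk⟩, rfl⟩ := Set.mem_iUnion₂.1 hx
  match l with
  | false :: l => exact mem_punctures hu hk
  | true :: l => exact mem_punctures hu hk
  | [] =>
    change alphaPre ⟨(b, []), u⟩ ∈ punctures
    match k with
    | 0 =>
      have h := mem_arc_zero.1 hu
      rw [alphaPre_stay _ _ hk.le]
      refine mem_punctures (k := 0) (mem_arc_zero.2 ?_) ?_
      · rw [stay_one, stay_two, hk]; norm_num
      · rw [stay_zero, h.2]; norm_num
    | 1 =>
      have h := mem_arc_one.1 hu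
      have h0 : u.1 0 ≤ 1 / 2 := by rw [h.2]; norm_num
      rw [alphaPre_stay _ _ h0]
      refine mem_punctures (k := 2) (mem_arc_two.2 ?_) ?_
      · rw [stay_zero, stay_one, h.1, h.2]; norm_num
      · rw [stay_two, hk, h.2]; norm_num
    | 2 =>
      have h := mem_arc_two.1 hu
      have h0 : 1 / 2 ≤ u.1 0 := by rw [h.1]; norm_num
      rw [alphaPre_cross _ _ h0]
      refine mem_punctures (k := 1) (mem_arc_one.2 ?_) ?_
      · rw [cross_zero, cross_two, h.1, h.2]; norm_num
      · rw [cross_one, hk, h.1]; norm_num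

/-- The action of `α` on the vertices away from the central edge. -/
def alphaVertex : Vertex → Vertex
  | (b, []) => (!b, [])
  | (b, false :: l) => (b, true :: l)
  | (b, true :: l) => (!b, false :: l)

lemma alphaVertex_pow_four (v : Vertex) :
    alphaVertex (alphaVertex (alphaVertex (alphaVertex v))) = v := by
  rcases v with ⟨_ | _, _ | ⟨_ | _, l⟩⟩ <;> rfl

lemma image_hex {φ : Surface → Surface} {v w : Vertex} (h : ∀ u, φ (pt v u) = pt w u) :
    φ '' hex v = hex w ∧ ∃ k : Fin 3, ∀ j : Fin 3, φ '' hexArc v j = hexArc w (j + k) := by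
  refine ⟨?_, 0, fun j => ?_⟩
  · rw [hex, ← Set.range_comp]; exact congrArg _ (funext h)
  · rw [add_zero, hexArc, Set.image_image]
    exact Set.image_congr fun u _ => h u

lemma alpha_isSupport :
    IsSupport alphaHomeo {(false, []), (true, [])} {(false, []), (true, [])} alphaVertex where
  finite_source := Set.toFinite _
  finite_target := Set.toFinite _
  image_region := by
    have hr : region {(false, []), (true, [])} = hex (false, []) ∪ hex (true, []) := by
      simp [region]
    have hm (b : Bool) (u : Hexagon) : pt (b, []) u ∈ hex (false, []) ∪ hex (true, []) := by
      cases b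
      exacts [Or.inl ⟨u, rfl⟩, Or.inr ⟨u, rfl⟩]
    rw [hr]
    apply image_alpha
    have key (b : Bool) (u : Hexagon) :
        alphaFun (pt (b, []) u) ∈ hex (false, []) ∪ hex (true, []) := by
      change alphaPre ⟨(b, []), u⟩ ∈ _
      rcases le_total (u.1 0) (1 / 2) with h0 | h0
      · rw [alphaPre_stay _ _ h0]; exact hm _ _
      · rw [alphaPre_cross _ _ h0]; exact hm _ _
    rintro _ (⟨u, rfl⟩ | ⟨u, rfl⟩)
    exacts [key _ u, key _ u]
  bijOn := by
    have hm : Set.MapsTo alphaVertex {(false, []), (true, [])}ᶜ {(false, []), (true, [])}ᶜ := by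
      rintro ⟨_ | _, _ | ⟨_ | _, l⟩⟩ h <;> simp_all [alphaVertex]
    refine ⟨hm, fun v _ w _ h => ?_, fun v hv => ⟨_, hm (hm (hm hv)), alphaVertex_pow_four v⟩⟩
    rw [← alphaVertex_pow_four v, h, alphaVertex_pow_four]
  rigid := by
    rintro ⟨_ | _, _ | ⟨_ | _, l⟩⟩ h
    · simp at h
    · exact image_hex fun _ => rfl
    · exact image_hex fun _ => rfl
    · simp at h
    · exact image_hex fun _ => rfl
    · exact image_hex fun _ => rfl

/-! ### The homeomorphism `β` -/

lemma betaPre_glue (p q : Hexagons) (h : Glue p q) :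
    Quot.mk Glue (betaPre p) = Quot.mk Glue (betaPre q) := by
  obtain ⟨v, u⟩ := p
  obtain ⟨w, u'⟩ := q
  obtain ⟨k, ha, hu, hu', he⟩ := h
  simp only at ha hu hu' he
  cases ha with
  | central => exact pt_eq (.left false []) (u := hexRot u) hu hu' he
  | left b l =>
    match b, l with
    | false, [] => exact pt_eq (.right false []) (u := hexRot u) hu hu' he
    | false, false :: l => exact pt_eq (.left false (true :: l)) hu hu' he
    | false, true :: l => exact pt_eq (.left true l) hu hu' he
    | true, l => exact pt_eq (.left false (false :: l)) hu hu' he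
  | right b l =>
    match b, l with
    | false, [] =>
      refine (pt_eq .central (u := hexRot u) hu hu' he)
    | false, false :: l => exact pt_eq (.right false (true :: l)) hu hu' he
    | false, true :: l => exact pt_eq (.right true l) hu hu' he
    | true, l => exact pt_eq (.right false (false :: l)) hu hu' he

/-- `β` as a map of the ribbon tree. -/
def betaFun : Surface → Surface :=
  Quot.lift (fun p => Quot.mk Glue (betaPre p)) betaPre_glue

lemma betaFun_root (u : Hexagon) : betaFun (pt (false, []) u) = pt (false, []) (hexRot u) := rfl

lemma hexRot_pow_three (u : Hexagon) : hexRot (hexRot (hexRot u)) = u :=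
  hexagon_ext rfl rfl rfl

lemma betaFun_pow_three (x : Surface) : betaFun (betaFun (betaFun x)) = x := by
  induction x using surface_ind with
  | h b l u =>
    match b, l with
    | false, [] => rw [betaFun_root, betaFun_root, betaFun_root, hexRot_pow_three]
    | false, false :: l => rfl
    | false, true :: l => rfl
    | true, l => rfl

lemma continuous_betaFun : Continuous betaFun := by
  refine continuous_quot_lift betaPre_glue (continuous_sigma ?_)
  rintro ⟨_ | _, _ | ⟨_ | _, l⟩⟩
  · refine (continuous_pt (false, [])).comp (g := pt (false, [])) (f := hexRot) ?_
    exact Continuous.subtype_mk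
      (continuous_pi fun k => (continuous_apply (k - 1)).comp
        (continuous_subtype_val : Continuous fun u : Hexagon => u.1)) _
  all_goals exact continuous_pt _

/-- The homeomorphism `β` of the ribbon tree. -/
def betaHomeo : Surface ≃ₜ Surface where
  toFun := betaFun
  invFun x := betaFun (betaFun x)
  left_inv := betaFun_pow_three
  right_inv := betaFun_pow_three
  continuous_toFun := continuous_betaFun
  continuous_invFun := continuous_betaFun.comp continuous_betaFun

lemma image_beta {s : Set Surface} (h : Set.MapsTo betaFun s s) : betaHomeo '' s = s :=
  Set.Subset.antisymm h.image_subset fun x hx => ⟨_, h (h hx), betaFun_pow_three x⟩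

lemma hexRot_mem_arc {u : Hexagon} {k : Fin 3} (h : u ∈ arc k) : hexRot u ∈ arc (k + 1) := by
  fin_cases k <;> exact h

lemma hexRot_mem_side {u : Hexagon} {k : Fin 3} (h : u ∈ side k) : hexRot u ∈ side (k + 1) := by
  fin_cases k <;> exact h

lemma mapsTo_beta_bdry : Set.MapsTo betaFun bdry bdry := by
  intro x hx
  obtain ⟨⟨b, l⟩, k, u, hu, rfl⟩ := Set.mem_iUnion₂.1 hx
  match b, l with
  | false, [] => exact mem_bdry (hexRot_mem_side hu)
  | false, false :: l => exact mem_bdry hu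
  | false, true :: l => exact mem_bdry hu
  | true, [] => exact mem_bdry hu
  | true, _ :: l => exact mem_bdry hu

lemma mapsTo_beta_punctures : Set.MapsTo betaFun punctures punctures := by
  intro x hx
  obtain ⟨⟨b, l⟩, k, u, ⟨hu, hk⟩, rfl⟩ := Set.mem_iUnion₂.1 hx
  match b, l with
  | false, [] =>
    refine mem_punctures (u := hexRot u) (hexRot_mem_arc hu) ?_
    change u.1 (k + 1 - 1) = _
    rwa [add_sub_cancel_right]
  | false, false :: l => exact mem_punctures hu hk
  | false, true :: l => exact mem_punctures hu hk
  | true, [] => exact mem_punctures hu hk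
  | true, _ :: l => exact mem_punctures hu hk

lemma betaVertex_pow_three (v : Vertex) : betaVertex (betaVertex (betaVertex v)) = v := by
  rcases v with ⟨_ | _, _ | ⟨_ | _, l⟩⟩ <;> rfl

lemma beta_isSupport : IsSupport betaHomeo {(false, [])} {(false, [])} betaVertex where
  finite_source := Set.toFinite _
  finite_target := Set.toFinite _
  image_region := by
    have hr : region {(false, [])} = hex (false, []) := by simp [region]
    rw [hr]
    apply image_beta
    rintro _ ⟨u, rfl⟩
    exact ⟨hexRot u, rfl⟩
  bijOn := by
    have hm : Set.MapsTo betaVertex {(false, [])}ᶜ {(false, [])}ᶜ := by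
      rintro ⟨_ | _, _ | ⟨_ | _, l⟩⟩ h <;> simp_all [betaVertex]
    refine ⟨hm, fun v _ w _ h => ?_, fun v hv => ⟨_, hm (hm hv), betaVertex_pow_three v⟩⟩
    rw [← betaVertex_pow_three v, h, betaVertex_pow_three]
  rigid := by
    rintro ⟨_ | _, _ | ⟨_ | _, l⟩⟩ h
    · simp at h
    all_goals exact image_hex fun _ => rfl

/-! ### The mapping classes `α*`, `β*`, `α`, `β` -/

/-- `α` as an asymptotically rigid homeomorphism of the punctured ribbon tree. -/
def alphaRigid : rigidHomeo punctures :=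
  ⟨alphaHomeo, ⟨image_alpha mapsTo_alpha_bdry, image_alpha mapsTo_alpha_punctures⟩,
    _, _, _, alpha_isSupport⟩

/-- `β` as an asymptotically rigid homeomorphism of the punctured ribbon tree. -/
def betaRigid : rigidHomeo punctures :=
  ⟨betaHomeo, ⟨image_beta mapsTo_beta_bdry, image_beta mapsTo_beta_punctures⟩,
    _, _, _, beta_isSupport⟩

/-- The element `α*` of `T*`. -/
def alphaStar (rel : Prop) : TStar rel := QuotientGroup.mk alphaRigid

/-- The element `β*` of `T*`. -/
def betaStar (rel : Prop) : TStar rel := QuotientGroup.mk betaRigid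

/-- The element `α` of `T`. -/
def alphaT : T := QuotientGroup.mk (Subgroup.inclusion (rigidHomeo_le punctures) alphaRigid)

/-- The element `β` of `T`. -/
def betaT : T := QuotientGroup.mk (Subgroup.inclusion (rigidHomeo_le punctures) betaRigid)

/-! ### The modular group -/

/-- The class in `PSL(2, ℤ)` of the matrix `!![0, -1; 1, 0]`, the half-turn `z ↦ -1 / z`. -/
def modularS : PSL(2, ℤ) := QuotientGroup.mk ModularGroup.S

/-- The matrix `!![0, 1; -1, 1]` in `SL(2, ℤ)`. -/
def slU : SL(2, ℤ) := ⟨!![0, 1; -1, 1], by simp [Matrix.det_fin_two]⟩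

/-- The class in `PSL(2, ℤ)` of the rotation `z ↦ 1 / (1 - z)` of order three, which permutes
cyclically the vertices `0, 1, ∞` of a Farey triangle. -/
def modularU : PSL(2, ℤ) := QuotientGroup.mk slU

end RibbonTree

end

noncomputable section

namespace RibbonTree

open Monoid Pointwise

/-! ### Homomorphisms out of the free product `ℤ/2 * ℤ/3` -/

section CyclicHom

variable {G : Type*} [Group G]

/-! The relations `(α²)² = 1` and `β³ = 1` hold already for the homeomorphisms, before any isotopy.
Since `PSL(2, ℤ)` is the free product of `⟨S⟩` and `⟨U⟩`, it therefore acts on the punctured ribbon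
tree by `S ↦ α²`, `U ↦ β` (`modularAction`), and this induces `s`; the map `i` is the composition of
`s` with `T* → T`. Everything reduces to the injectivity of `i`
(`forget_comp_modularToTStar_injective`): it gives the injectivity of `s`, transports the orders of
`S` and `U`, and makes `T* → T` injective on the image of `s`.

The invariant that detects elements of `T` is the permutation of the boundary components of the
ribbon tree. With the hexagons viewed as the Farey triangles, these components correspond to the
cusps, that is, to the cosets of the parabolic subgroup `⟨S U⟩`, the stabilizer of `∞`. Each
boundary side gets such a coset as its label, compatibly with the gluing. The label is locally
constant on the boundary, so an isotopy that preserves the boundary cannot change it, whether or not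
it respects the punctures (`IsotopicToId.mem_labels`). On labels `α²` acts as left multiplication by
`S` and `β` as left multiplication by `U`, hence `g` acts by `g` (`modularAction_mem`). If the
action of `g` is isotopic to the identity, `g` fixes every cusp, in particular `∞` and `S ∞ = 0`;
then `g` is represented by a matrix both upper and lower triangular, so `g = 1`
(`eq_one_of_labelAction`).

The free product decomposition of `PSL(2, ℤ)` is a ping-pong argument on the sign of the cusp `g ∞`,
together with the generation of `SL(2, ℤ)` by `S` and the translation `(S U)⁻¹`. -/

/-- The homomorphism from the cyclic group of order `n` with prescribed image of the generator. -/
def cyclicHom (n : ℕ) (g : G) (h : g ^ n = 1) : Multiplicative (ZMod n) →* G :=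
  AddMonoidHom.toMultiplicativeLeft
    (ZMod.lift n ⟨(zpowersHom G g).toAdditiveRight, by
      change Additive.ofMul (g ^ (n : ℤ)) = 0
      rw [zpow_natCast, h]; rfl⟩)

lemma cyclicHom_ofAdd_intCast (n : ℕ) (g : G) (h : g ^ n = 1) (m : ℤ) :
    cyclicHom n g h (Multiplicative.ofAdd (m : ZMod n)) = g ^ m := by
  change Additive.toMul (ZMod.lift n _ (m : ZMod n)) = _
  rw [ZMod.lift_coe]; rfl

lemma cyclicHom_ofAdd_one (n : ℕ) (g : G) (h : g ^ n = 1) :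
    cyclicHom n g h (Multiplicative.ofAdd 1) = g := by
  simpa using cyclicHom_ofAdd_intCast n g h 1

/-- The homomorphism from `ℤ/2 * ℤ/3` given by an element of order dividing two and one of order
dividing three. -/
def modularLift (a b : G) (ha : a ^ 2 = 1) (hb : b ^ 3 = 1) :
    Coprod (Multiplicative (ZMod 2)) (Multiplicative (ZMod 3)) →* G :=
  Coprod.lift (cyclicHom 2 a ha) (cyclicHom 3 b hb)

lemma modularLift_inl (a b : G) (ha : a ^ 2 = 1) (hb : b ^ 3 = 1) :
    modularLift a b ha hb (Coprod.inl (Multiplicative.ofAdd 1)) = a := by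
  rw [modularLift, Coprod.lift_apply_inl, cyclicHom_ofAdd_one]

lemma modularLift_inr (a b : G) (ha : a ^ 2 = 1) (hb : b ^ 3 = 1) :
    modularLift a b ha hb (Coprod.inr (Multiplicative.ofAdd 1)) = b := by
  rw [modularLift, Coprod.lift_apply_inr, cyclicHom_ofAdd_one]

end CyclicHom

/-! ### The modular group as a free product -/

/-- The centre consists of the scalar matrices `r` with `r ^ 2 = 1`, and over `ℤ` this leaves `r =
±1`. -/
lemma modular_mk_eq_iff (A B : SL(2, ℤ)) :
    (QuotientGroup.mk A : PSL(2, ℤ)) = QuotientGroup.mk B ↔ A = B ∨ A = -B := by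
  rw [QuotientGroup.eq, Matrix.SpecialLinearGroup.mem_center_iff]
  constructor
  · rintro ⟨r, hr, h⟩
    have h1 : B = A * (A⁻¹ * B) := by group
    have h2 : (B : Matrix (Fin 2) (Fin 2) ℤ) = A.1 * Matrix.scalar (Fin 2) r := by
      rw [h]; exact congrArg Subtype.val h1
    rcases eq_or_eq_neg_of_sq_eq_sq r 1 (by simpa using hr) with rfl | rfl
    · left; ext i j; rw [h2]; simp
    · right; ext i j; simp [h2]
  · rintro (rfl | rfl)
    · exact ⟨1, by simp, by simp⟩
    · exact ⟨-1, by simp, by simp⟩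

lemma coe_slU : (slU : Matrix (Fin 2) (Fin 2) ℤ) = !![0, 1; -1, 1] := rfl

lemma modularS_sq : modularS ^ 2 = 1 := by
  refine (modular_mk_eq_iff (ModularGroup.S ^ 2) 1).2 (Or.inr ?_)
  ext i j; fin_cases i <;> fin_cases j <;> simp [ModularGroup.coe_S, pow_two]

lemma modularU_pow_three : modularU ^ 3 = 1 := by
  refine (modular_mk_eq_iff (slU ^ 3) 1).2 (Or.inr ?_)
  ext i j; fin_cases i <;> fin_cases j <;> simp [coe_slU, pow_succ]

lemma modularS_ne_one : modularS ≠ 1 := by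
  intro h
  rcases (modular_mk_eq_iff ModularGroup.S 1).1 h with h | h <;>
    simpa [ModularGroup.S] using congrArg (fun A : SL(2, ℤ) => A 0 1) h

lemma modularU_ne_one : modularU ≠ 1 := by
  intro h
  rcases (modular_mk_eq_iff slU 1).1 h with h | h <;>
    simpa [slU] using congrArg (fun A : SL(2, ℤ) => A 0 1) h

/-- This brings the usual generators `S`, `T` into the subgroup generated by `S` and `U`, and also
identifies `S U` as a parabolic element fixing `∞`. -/
lemma S_mul_slU : ModularGroup.S * slU = ModularGroup.T⁻¹ := by
  ext i j; fin_cases i <;> fin_cases j <;>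
    simp [ModularGroup.coe_S, ModularGroup.coe_T, coe_slU, Matrix.adjugate_fin_two]

lemma closure_modular : Subgroup.closure {modularS, modularU} = (⊤ : Subgroup PSL(2, ℤ)) := by
  have h : (⊤ : Subgroup SL(2, ℤ)) ≤ Subgroup.closure {ModularGroup.S, slU} := by
    rw [← SpecialLinearGroup.SL2Z_generators, Subgroup.closure_le]
    have hS : ModularGroup.S ∈ Subgroup.closure {ModularGroup.S, slU} :=
      Subgroup.subset_closure (Or.inl rfl)
    have hU : slU ∈ Subgroup.closure {ModularGroup.S, slU} :=
      Subgroup.subset_closure (Or.inr rfl)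
    rintro _ (rfl | rfl)
    · exact hS
    · rw [SetLike.mem_coe, ← inv_mem_iff, ← S_mul_slU]
      exact mul_mem hS hU
  have h' := congrArg (Subgroup.map (QuotientGroup.mk' (Subgroup.center SL(2, ℤ))))
    (top_le_iff.1 h)
  rw [MonoidHom.map_closure, Set.image_pair, Subgroup.map_top_of_surjective _
    (QuotientGroup.mk'_surjective _)] at h'
  exact h'

/-! ### Ping-pong for the free product decomposition -/

/-- The product of the entries of the first column, which is well-defined on `PSL(2, ℤ)`. -/
def columnProd : PSL(2, ℤ) → ℤ :=
  Quotient.lift (fun A : SL(2, ℤ) => A 0 0 * A 1 0) <| by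
    intro A B h
    rcases (modular_mk_eq_iff A B).1 (Quotient.sound h) with rfl | rfl <;> simp

/-- The sign of `columnProd g` is the sign of the cusp `g ∞ = a / c`, and `S` is `z ↦ -1 / z`. -/
lemma columnProd_S_mul (g : PSL(2, ℤ)) : columnProd (modularS * g) = -columnProd g := by
  induction g using QuotientGroup.induction_on with
  | H A =>
    change (ModularGroup.S * A) 0 0 * (ModularGroup.S * A) 1 0 = -(A 0 0 * A 1 0)
    simp [ModularGroup.coe_S, Matrix.mul_apply, mul_comm]

/-- The map `z ↦ 1 / (1 - z)` takes the negative half-line into `(0, 1)`, and this interval into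
`(1, ∞)`. In terms of the column `(a, c)`, the two products are `c² - a c` and `a² - a c`. -/
lemma columnProd_U_mul {g : PSL(2, ℤ)} (h : columnProd g < 0) :
    0 < columnProd (modularU * g) ∧ 0 < columnProd (modularU * (modularU * g)) := by
  induction g using QuotientGroup.induction_on with
  | H A =>
    change A 0 0 * A 1 0 < 0 at h
    change 0 < (slU * A) 0 0 * (slU * A) 1 0 ∧
      0 < (slU * (slU * A)) 0 0 * (slU * (slU * A)) 1 0
    simp only [Matrix.SpecialLinearGroup.coe_mul, coe_slU, Matrix.mul_apply, Fin.sum_univ_two]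
    simp
    constructor <;> nlinarith [sq_nonneg (A 0 0), sq_nonneg (A 1 0)]

/-- The free factors of the modular group, indexed by `false` and `true`. -/
abbrev factor (i : Bool) : Type := Multiplicative (ZMod (cond i 3 2))

/-- The inclusions of the free factors into the modular group. -/
def factorHom : (i : Bool) → factor i →* PSL(2, ℤ)
  | false => cyclicHom 2 modularS modularS_sq
  | true => cyclicHom 3 modularU modularU_pow_three

lemma factorHom_injective : Function.Injective (CoprodI.lift factorHom) := by
  refine CoprodI.lift_injective_of_ping_pong factorHom
    -- With only two factors, the ping-pong lemma needs one with at least three elements.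
    (Or.inr ⟨true, by
      change (3 : Cardinal) ≤ Cardinal.mk (Multiplicative (ZMod 3))
      simp⟩)
    -- The ping-pong sets lie in the group itself, acting by left multiplication: `S` takes positive
    -- to negative, while `U` and `U²` take negative to positive.
    (fun i => {g | cond i (0 < columnProd g) (columnProd g < 0)}) ?_ ?_ ?_
  · have hpos : ∃ g, 0 < columnProd g := by
      -- `U S` is the matrix with rows `(1, 0)` and `(1, 1)`, so its column product is `1`.
      refine ⟨QuotientGroup.mk (slU * ModularGroup.S), ?_⟩
      change 0 < (slU * ModularGroup.S) 0 0 * (slU * ModularGroup.S) 1 0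
      simp [coe_slU, ModularGroup.coe_S]
    obtain ⟨g, hg⟩ := hpos
    rintro (_ | _)
    · exact ⟨modularS * g, by simpa [columnProd_S_mul] using hg⟩
    · exact ⟨g, hg⟩
  · rintro (_ | _) (_ | _) hij
    · exact absurd rfl hij
    · exact Set.disjoint_left.2 fun g h h' => lt_asymm (show columnProd g < 0 from h) h'
    · exact Set.disjoint_left.2 fun g h h' => lt_asymm (show columnProd g < 0 from h') h
    · exact absurd rfl hij
  · rintro (_ | _) (_ | _) hij
    · exact absurd rfl hij
    · intro x hx
      have hx' : x = Multiplicative.ofAdd (1 : ZMod 2) := by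
        exact (by decide : ∀ x : Multiplicative (ZMod 2), x ≠ 1 →
          x = Multiplicative.ofAdd (1 : ZMod 2)) x hx
      subst hx'
      rintro _ ⟨g, hg, rfl⟩
      change columnProd (cyclicHom 2 modularS modularS_sq (Multiplicative.ofAdd 1) * g) < 0
      rw [cyclicHom_ofAdd_one, columnProd_S_mul]
      exact neg_neg_of_pos hg
    · intro x hx
      have hx' : x = Multiplicative.ofAdd (1 : ZMod 3) ∨
          x = Multiplicative.ofAdd (1 : ZMod 3) * Multiplicative.ofAdd (1 : ZMod 3) := by
        exact (by decide : ∀ x : Multiplicative (ZMod 3), x ≠ 1 →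
          x = Multiplicative.ofAdd (1 : ZMod 3) ∨
          x = Multiplicative.ofAdd (1 : ZMod 3) * Multiplicative.ofAdd (1 : ZMod 3)) x hx
      rintro _ ⟨g, hg, rfl⟩
      rcases hx' with rfl | rfl
      · change 0 < columnProd (cyclicHom 3 modularU modularU_pow_three
          (Multiplicative.ofAdd 1) * g)
        rw [cyclicHom_ofAdd_one]
        exact (columnProd_U_mul hg).1
      · change 0 < columnProd (cyclicHom 3 modularU modularU_pow_three
          (Multiplicative.ofAdd 1 * Multiplicative.ofAdd 1) * g)
        rw [map_mul, cyclicHom_ofAdd_one, mul_assoc]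
        exact (columnProd_U_mul hg).2
    · exact absurd rfl hij

lemma modularLift_injective :
    Function.Injective (modularLift modularS modularU modularS_sq modularU_pow_three) := by
  let j : Coprod (Multiplicative (ZMod 2)) (Multiplicative (ZMod 3)) →* CoprodI factor :=
    Coprod.lift (CoprodI.of (M := factor) (i := false)) (CoprodI.of (M := factor) (i := true))
  let r : CoprodI factor →* Coprod (Multiplicative (ZMod 2)) (Multiplicative (ZMod 3)) :=
    CoprodI.lift fun
      | false => Coprod.inl
      | true => Coprod.inr
  -- Ping-pong concerns the indexed free product; the binary one embeds in it because `r` is a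
  -- retraction of `j`.
  have hj : Function.Injective j := by
    refine Function.LeftInverse.injective (g := r) fun w => ?_
    have : r.comp j = MonoidHom.id _ := by
      refine Coprod.hom_ext ?_ ?_ <;> ext x <;> simp [r, j]
    exact DFunLike.congr_fun this w
  have h : modularLift modularS modularU modularS_sq modularU_pow_three =
      (CoprodI.lift factorHom).comp j := by
    refine Coprod.hom_ext ?_ ?_ <;> ext x <;> simp [j, modularLift, factorHom]
  rw [h]
  exact factorHom_injective.comp hj

lemma modularLift_surjective :
    Function.Surjective (modularLift modularS modularU modularS_sq modularU_pow_three) := by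
  rw [← MonoidHom.range_eq_top, ← top_le_iff, ← closure_modular, Subgroup.closure_le]
  rintro _ (rfl | rfl)
  · exact ⟨_, modularLift_inl _ _ _ _⟩
  · exact ⟨_, modularLift_inr _ _ _ _⟩

/-- The modular group is the free product of the subgroups generated by `S` and by `U`. -/
def modularEquiv : Coprod (Multiplicative (ZMod 2)) (Multiplicative (ZMod 3)) ≃* PSL(2, ℤ) :=
  MulEquiv.ofBijective (modularLift modularS modularU modularS_sq modularU_pow_three)
    ⟨modularLift_injective, modularLift_surjective⟩

lemma modularEquiv_inl : modularEquiv (Coprod.inl (Multiplicative.ofAdd 1)) = modularS :=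
  modularLift_inl _ _ modularS_sq modularU_pow_three

lemma modularEquiv_inr : modularEquiv (Coprod.inr (Multiplicative.ofAdd 1)) = modularU :=
  modularLift_inr _ _ modularS_sq modularU_pow_three

/-! ### The parabolic subgroup generated by `S U` -/

/-- The subgroup generated by the translation `S U`. -/
def parabolic : Subgroup PSL(2, ℤ) := Subgroup.zpowers (modularS * modularU)

/-- Elements of the parabolic subgroup are, up to sign, powers of the translation `T`. -/
lemma lower_entry_eq_zero {A : SL(2, ℤ)} (h : (QuotientGroup.mk A : PSL(2, ℤ)) ∈ parabolic) :
    A 1 0 = 0 := by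
  obtain ⟨n, hn⟩ := h
  have h1 : (QuotientGroup.mk (ModularGroup.T ^ (-n)) : PSL(2, ℤ)) = QuotientGroup.mk A := by
    refine Eq.trans ?_ hn
    change QuotientGroup.mk _ = QuotientGroup.mk ((ModularGroup.S * slU) ^ n)
    rw [S_mul_slU, inv_zpow']
  rcases (modular_mk_eq_iff _ _).1 h1.symm with rfl | rfl <;> simp [ModularGroup.coe_T_zpow]

/-- The parabolic subgroup meets its conjugate by `S` trivially. -/
lemma eq_one_of_mem_parabolic {g : PSL(2, ℤ)} (h : g ∈ parabolic)
    (h' : modularS⁻¹ * (g * modularS) ∈ parabolic) : g = 1 := by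
  induction g using QuotientGroup.induction_on with
  | H A =>
    have h1 := lower_entry_eq_zero h
    have h2 : (ModularGroup.S⁻¹ * (A * ModularGroup.S)) 1 0 = 0 := lower_entry_eq_zero h'
    -- Conjugation by `S` exchanges the cusps `∞` and `0`, and up to sign the two off-diagonal
    -- entries; so `A` is diagonal of determinant one.
    have h3 : A 0 1 = 0 := by
      simpa [ModularGroup.coe_S, Matrix.mul_apply, Matrix.adjugate_fin_two] using h2
    have hd := A.det_coe
    rw [Matrix.det_fin_two, h1, h3, mul_zero, sub_zero] at hd
    refine (modular_mk_eq_iff A 1).2 ?_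
    rcases Int.mul_eq_one_iff_eq_one_or_neg_one.1 hd with ⟨h0, h4⟩ | ⟨h0, h4⟩
    · left; ext i j; fin_cases i <;> fin_cases j <;> simp [h0, h1, h3, h4]
    · right; ext i j; fin_cases i <;> fin_cases j <;> simp [h0, h1, h3, h4]

/-! ### Labels of the boundary components -/

/-- The set of labels: cosets of the parabolic subgroup, that is, cusps. -/
abbrev Label : Type := PSL(2, ℤ) ⧸ parabolic

/-- The element of the modular group that takes the frame of a hexagon to that of a child. -/
def step (c : Bool) : PSL(2, ℤ) := cond c (modularU * modularU * modularS) (modularU * modularS)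

/-- The element of the modular group that takes the central hexagon to the hexagon at `v`. -/
def frame (v : Vertex) : PSL(2, ℤ) := cond v.1 modularS 1 * (v.2.map step).prod

/-- The label of the boundary side `k` of the hexagon at `v`. -/
def label (v : Vertex) (k : Fin 3) : Label :=
  -- The shift by `2` gives the sides `1` and `2` of the central hexagon, which bound its arc `0`,
  -- the cusps `∞` and `U ∞ = 0`; these are exchanged by `S`, the half-turn about that arc.
  QuotientGroup.mk (frame v * modularU ^ (k.val + 2))

/-- Crossing the arc `k` amounts to turning the hexagon until that arc is in position `0`, then
making the half-turn `S` about it. -/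
lemma frame_adj {v w : Vertex} {k : Fin 3} (h : Adj v k w) :
    frame w = frame v * modularU ^ k.val * modularS := by
  cases h with
  | central => simp [frame]
  | left b l => simp [frame, step, mul_assoc]
  | right b l => simp [frame, step, mul_assoc, pow_two]

lemma modularS_mul_self : modularS * modularS = 1 := by rw [← pow_two, modularS_sq]

lemma mk_mul_parabolic (g : PSL(2, ℤ)) :
    (QuotientGroup.mk (g * (modularS * modularU)) : Label) = QuotientGroup.mk g :=
  QuotientGroup.mk_mul_of_mem g (Subgroup.mem_zpowers _)

lemma label_add_one (v : Vertex) (k : Fin 3) :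
    label v (k + 1) = QuotientGroup.mk (frame v * modularU ^ k.val) := by
  have h := modularU_pow_three
  fin_cases k
  · change QuotientGroup.mk (frame v * modularU ^ 3) = QuotientGroup.mk (frame v * modularU ^ 0)
    rw [h, pow_zero]
  · change QuotientGroup.mk (frame v * modularU ^ (3 + 1)) =
      QuotientGroup.mk (frame v * modularU ^ 1)
    rw [pow_add, h, one_mul]
  · rfl

lemma label_add_two (v : Vertex) (k : Fin 3) :
    label v (k + 2) = QuotientGroup.mk (frame v * modularU ^ (k.val + 1)) := by
  have h := modularU_pow_three
  fin_cases k
  · change QuotientGroup.mk (frame v * modularU ^ (3 + 1)) =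
      QuotientGroup.mk (frame v * modularU ^ 1)
    rw [pow_add, h, one_mul]
  · rfl
  · change QuotientGroup.mk (frame v * modularU ^ 3) =
      QuotientGroup.mk (frame v * modularU ^ (2 + 1))
    rfl

/-- The gluing reverses the arc, so its two ends are exchanged. The labels agree because `U^k S` and
`U^(k+1) = U^k S (S U)` lie in one coset of `⟨S U⟩`, as do `U^k` and `U^k S U`. -/
lemma label_adj {v w : Vertex} {k : Fin 3} (h : Adj v k w) :
    label w (0 + 1) = label v (k + 2) ∧ label w (0 + 2) = label v (k + 1) := by
  simp only [label_add_one, label_add_two, frame_adj h]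
  constructor
  · rw [← mk_mul_parabolic]
    congr 1
    simp only [Fin.val_zero, pow_zero, mul_one, pow_succ, mul_assoc]
    rw [← mul_assoc modularS modularS, modularS_mul_self, one_mul]
  · rw [← mk_mul_parabolic (frame v * modularU ^ k.val)]
    simp [mul_assoc]

/-- The labels of the boundary sides of the hexagon at `p.1` that contain `p.2`. -/
def preLabels (p : Hexagons) : Set Label := {ℓ | ∃ k, p.2 ∈ side k ∧ label p.1 k = ℓ}

/-- The sides meet an arc only at its two endpoints, where the coordinate along the arc is `1` or
`0`. -/
lemma side_of_mem_arc {u : Hexagon} {k : Fin 3} (h : u ∈ arc k) :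
    (u ∈ side (k + 1) ↔ u.1 k = 1) ∧ (u ∈ side (k + 2) ↔ u.1 k = 0) ∧ u ∉ side k := by
  obtain ⟨h1, h2⟩ := h
  fin_cases k
  · change u.1 1 = 1 at h1; change u.1 2 = 0 at h2
    refine ⟨?_, ?_, ?_⟩
    · change u.1 2 = 0 ∧ u.1 0 = 1 ↔ u.1 0 = 1; tauto
    · change u.1 0 = 0 ∧ u.1 1 = 1 ↔ u.1 0 = 0; tauto
    · change ¬(u.1 1 = 0 ∧ u.1 2 = 1); rw [h1]; simp
  · change u.1 2 = 1 at h1; change u.1 0 = 0 at h2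
    refine ⟨?_, ?_, ?_⟩
    · change u.1 0 = 0 ∧ u.1 1 = 1 ↔ u.1 1 = 1; tauto
    · change u.1 1 = 0 ∧ u.1 2 = 1 ↔ u.1 1 = 0; tauto
    · change ¬(u.1 2 = 0 ∧ u.1 0 = 1); rw [h1]; simp
  · change u.1 0 = 1 at h1; change u.1 1 = 0 at h2
    refine ⟨?_, ?_, ?_⟩
    · change u.1 1 = 0 ∧ u.1 2 = 1 ↔ u.1 2 = 1; tauto
    · change u.1 2 = 0 ∧ u.1 0 = 1 ↔ u.1 2 = 0; tauto
    · change ¬(u.1 0 = 0 ∧ u.1 1 = 1); rw [h1]; simp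

lemma eq_or_eq_add_one_or (j k : Fin 3) : j = k ∨ j = k + 1 ∨ j = k + 2 := by
  revert j k; decide

lemma mem_preLabels_of_mem_arc {v : Vertex} {u : Hexagon} {k : Fin 3} (h : u ∈ arc k)
    (ℓ : Label) : ℓ ∈ preLabels ⟨v, u⟩ ↔
      u.1 k = 1 ∧ label v (k + 1) = ℓ ∨ u.1 k = 0 ∧ label v (k + 2) = ℓ := by
  obtain ⟨h1, h2, h0⟩ := side_of_mem_arc h
  rw [← h1, ← h2]
  constructor
  · rintro ⟨j, hj, hℓ⟩
    rcases eq_or_eq_add_one_or j k with rfl | rfl | rfl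
    · exact absurd hj h0
    · exact Or.inl ⟨hj, hℓ⟩
    · exact Or.inr ⟨hj, hℓ⟩
  · rintro (⟨hj, hℓ⟩ | ⟨hj, hℓ⟩)
    exacts [⟨_, hj, hℓ⟩, ⟨_, hj, hℓ⟩]

/-- Only endpoints of arcs carry labels here. The substitution of `1 - u` for `u` exchanges the
endpoints exactly as `label_adj` exchanges the labels. -/
lemma preLabels_glue (p q : Hexagons) (h : Glue p q) : preLabels p = preLabels q := by
  obtain ⟨v, u⟩ := p
  obtain ⟨w, u'⟩ := q
  obtain ⟨k, ha, hu, hu', he⟩ := h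
  simp only at ha hu hu' he
  ext ℓ
  rw [mem_preLabels_of_mem_arc hu, mem_preLabels_of_mem_arc hu', he, (label_adj ha).1,
    (label_adj ha).2, or_comm]
  have e1 : (1 - u.1 k = 1) ↔ u.1 k = 0 := by constructor <;> intro h <;> linarith
  have e2 : (1 - u.1 k = 0) ↔ u.1 k = 1 := by constructor <;> intro h <;> linarith
  rw [e1, e2]

/-- The set of labels of a point of the ribbon tree; it is empty in the interior and contains
the label of the boundary component on the boundary. -/
def labels : Surface → Set Label := Quot.lift preLabels preLabels_glue

/-! ### Isotopy invariance of the label -/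

/-- The coordinate `i + 2` is `1` on the side `i` and `0` on the side `i + 1`, and any two distinct
sides are consecutive in the cyclic order. -/
lemma side_inj {u : Hexagon} {j k : Fin 3} (hj : u ∈ side j) (hk : u ∈ side k) : j = k := by
  have h0 (i : Fin 3) (h : u ∈ side i) (h' : u ∈ side (i + 1)) : False := by
    have h1 : u.1 (i + 2) = 1 := h.2
    have h2 : u.1 (i + 1 + 1) = 0 := h'.1
    rw [add_assoc, show (1 + 1 : Fin 3) = 2 from rfl, h1] at h2
    exact one_ne_zero h2
  rcases eq_or_eq_add_one_or j k with rfl | rfl | rfl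
  · rfl
  · exact (h0 _ hk hj).elim
  · refine (h0 _ hj ?_).elim
    rwa [add_assoc, show (2 + 1 : Fin 3) = 0 from rfl, add_zero]

lemma labels_subsingleton (x : Surface) : (labels x).Subsingleton := by
  induction x using surface_ind with
  | h b l u =>
    rintro ℓ ⟨j, hj, rfl⟩ m ⟨k, hk, rfl⟩
    rw [side_inj hj hk]

lemma labels_nonempty {x : Surface} (h : x ∈ bdry) : (labels x).Nonempty := by
  obtain ⟨v, k, u, hu, rfl⟩ := Set.mem_iUnion₂.1 h
  exact ⟨_, k, hu, rfl⟩

lemma isClosed_side (k : Fin 3) : IsClosed (side k) := by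
  have hc (k : Fin 3) : Continuous fun u : Hexagon => u.1 k :=
    (continuous_apply k).comp continuous_subtype_val
  exact (isClosed_eq (hc _) continuous_const).inter (isClosed_eq (hc _) continuous_const)

/-- In the quotient topology closedness can be tested on each hexagon, where only finitely many
sides occur. Hence `Y` may be infinite, and using `Y` together with its complement makes the label
locally constant on the boundary. -/
lemma isClosed_labels_inter (Y : Set Label) : IsClosed {x | ∃ ℓ ∈ Y, ℓ ∈ labels x} := by
  refine isQuotientMap_quot_mk.isClosed_preimage.1 (isClosed_sigma_iff.2 fun v => ?_)
  have h : ((fun u => (⟨v, u⟩ : Hexagons)) ⁻¹'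
      (Quot.mk Glue ⁻¹' {x | ∃ ℓ ∈ Y, ℓ ∈ labels x}) : Set Hexagon) =
      ⋃ k ∈ {k | label v k ∈ Y}, side k := by
    ext u
    simp only [Set.mem_iUnion]
    constructor
    · rintro ⟨ℓ, hℓ, k, hk, rfl⟩
      exact ⟨k, hℓ, hk⟩
    · rintro ⟨k, hℓ, hk⟩
      exact ⟨_, hℓ, k, hk, rfl⟩
  refine h ▸ ?_
  exact (Set.toFinite _).isClosed_biUnion fun k _ => isClosed_side k

/-- The label is constant along paths in the boundary. -/
lemma mem_labels_of_path {γ : unitInterval → Surface} (hγ : Continuous γ)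
    (hb : ∀ t, γ t ∈ bdry) {ℓ : Label} (h : ℓ ∈ labels (γ 0)) (t : unitInterval) :
    ℓ ∈ labels (γ t) := by
  have h1 := (isClosed_labels_inter {ℓ}).preimage hγ
  have h2 := (isClosed_labels_inter {ℓ}ᶜ).preimage hγ
  -- Every point of the path has exactly one label, so the two closed sets are complementary, and
  -- the connectedness of the interval decides between them.
  have hc : (γ ⁻¹' {x | ∃ m ∈ ({ℓ} : Set Label)ᶜ, m ∈ labels x})ᶜ =
      γ ⁻¹' {x | ∃ m ∈ ({ℓ} : Set Label), m ∈ labels x} := by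
    ext s
    constructor
    · intro hs
      obtain ⟨m, hm⟩ := labels_nonempty (hb s)
      exact ⟨m, by_contra fun hne => hs ⟨m, hne, hm⟩, hm⟩
    · rintro ⟨m, rfl, hm⟩ ⟨n, hn, hn'⟩
      exact hn (labels_subsingleton _ hn' hm)
  have hclopen : IsClopen (γ ⁻¹' {x | ∃ m ∈ ({ℓ} : Set Label), m ∈ labels x}) :=
    ⟨h1, hc ▸ h2.isOpen_compl⟩
  rcases isClopen_iff.1 hclopen with he | he
  · exact absurd (show (0 : unitInterval) ∈
      γ ⁻¹' {x | ∃ m ∈ ({ℓ} : Set Label), m ∈ labels x} from ⟨ℓ, rfl, h⟩)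
      (he ▸ Set.notMem_empty _)
  · obtain ⟨m, rfl, hm⟩ := he.symm ▸ Set.mem_univ t
    exact hm

/-- Every stage of the isotopy preserves the boundary, so the track of a boundary point is a path in
the boundary. Neither the marked points nor a pointwise fixed boundary is needed. -/
lemma IsotopicToId.mem_labels {P : Set Surface} {rel : Prop} {φ : Surface ≃ₜ Surface}
    (h : IsotopicToId P rel φ) {x : Surface} (hx : x ∈ bdry) {ℓ : Label} (hℓ : ℓ ∈ labels x) :
    ℓ ∈ labels (φ x) := by
  obtain ⟨H, hH, hψ, h0, h1, -⟩ := h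
  rw [← h1]
  refine mem_labels_of_path (γ := fun t => H (t, x)) (hH.comp (by fun_prop)) (fun t => ?_) ?_ 1
  · obtain ⟨ψ, hm, he⟩ := hψ t
    rw [he, ← hm.1]
    exact Set.mem_image_of_mem _ hx
  · rwa [h0]

/-! ### The action on labels -/

lemma frame_halfTurn (b : Bool) (l : List Bool) :
    frame (!b, l) = modularS * frame (b, l) := by
  cases b
  · simp [frame]
  · simp [frame, ← mul_assoc, modularS_mul_self]

lemma mem_labels_halfTurn {x : Surface} {ℓ : Label} (h : ℓ ∈ labels x) :
    modularS • ℓ ∈ labels (halfTurn x) := by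
  induction x using surface_ind with
  | h b l u =>
    obtain ⟨k, hk, rfl⟩ := h
    refine ⟨k, hk, ?_⟩
    change QuotientGroup.mk (frame (!b, l) * _) = QuotientGroup.mk (modularS * (frame (b, l) * _))
    rw [frame_halfTurn, mul_assoc]

/-- The central vertex is excluded because it is fixed while its hexagon is turned: there `U` shows
up as a shift of the sides instead. -/
lemma frame_betaVertex {v : Vertex} (h : v ≠ (false, [])) :
    frame (betaVertex v) = modularU * frame v := by
  have hU : modularU * (modularU * modularU) = 1 := by
    rw [← modularU_pow_three, pow_succ, pow_two, mul_assoc]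
  rcases v with ⟨_ | _, _ | ⟨_ | _, l⟩⟩
  · exact absurd rfl h
  · simp [betaVertex, frame, step, mul_assoc]
  · change modularS * _ = modularU * (1 * (modularU * modularU * modularS * (l.map step).prod))
    rw [one_mul, ← mul_assoc, ← mul_assoc, hU, one_mul]
    rfl
  all_goals simp [betaVertex, frame, step, mul_assoc]

lemma mem_labels_betaFun {x : Surface} {ℓ : Label} (h : ℓ ∈ labels x) :
    modularU • ℓ ∈ labels (betaFun x) := by
  induction x using surface_ind with
  | h b l u =>
    obtain ⟨k, hk, rfl⟩ := h
    by_cases hv : ((b, l) : Vertex) = (false, [])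
    · obtain ⟨rfl, rfl⟩ := Prod.mk.injEq .. ▸ hv
      -- On the central hexagon, whose frame is `1`, raising the index of the side by one multiplies
      -- its label by `U`, since `U³ = 1`.
      refine ⟨k + 1, hexRot_mem_side hk, ?_⟩
      change label (false, []) (k + 1) =
        QuotientGroup.mk (modularU * (frame (false, []) * modularU ^ (k.val + 2)))
      rw [label_add_one, show frame (false, []) = 1 by simp [frame], one_mul, one_mul,
        ← pow_succ', add_assoc, pow_add, modularU_pow_three, mul_one]
    · change modularU • label (b, l) k ∈
        preLabels ⟨betaVertex (b, l), if (b, l) = (false, []) then hexRot u else u⟩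
      rw [if_neg hv]
      refine ⟨k, hk, ?_⟩
      change QuotientGroup.mk (frame (betaVertex (b, l)) * _) =
        QuotientGroup.mk (modularU * (frame (b, l) * _))
      rw [frame_betaVertex hv, mul_assoc]

/-- The pairs consisting of a boundary-preserving homeomorphism and of an element of the modular
group by which it acts on the labels. -/
def labelAction (P : Set Surface) : Subgroup (rigidHomeo P × PSL(2, ℤ)) where
  carrier := {p | ∀ x ∈ bdry, ∀ ℓ ∈ labels x, p.2 • ℓ ∈ labels (p.1.1 x)}
  one_mem' x _ ℓ hℓ := by simpa using hℓ
  mul_mem' := by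
    rintro ⟨φ, g⟩ ⟨ψ, h⟩ hφ hψ x hx ℓ hℓ
    have := hφ _ (ψ.2.1.1 ▸ Set.mem_image_of_mem ψ.1 hx) _ (hψ x hx ℓ hℓ)
    simpa [mul_smul] using this
  inv_mem' := by
    rintro ⟨φ, g⟩ hφ x hx ℓ hℓ
    have hy : (φ⁻¹).1 x ∈ bdry := (φ⁻¹).2.1.1 ▸ Set.mem_image_of_mem (φ⁻¹).1 hx
    -- The preimage of `x` has a label `m`; its image `g • m` must be the unique label `ℓ` of `x`,
    -- so `m = g⁻¹ • ℓ`.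
    obtain ⟨m, hm⟩ := labels_nonempty hy
    have h1 := hφ _ hy m hm
    have h2 : φ.1 ((φ⁻¹).1 x) = x := φ.1.apply_symm_apply x
    change g • m ∈ labels (φ.1 ((φ⁻¹).1 x)) at h1
    rw [h2] at h1
    rw [labels_subsingleton x hℓ h1]
    simpa using hm

/-- Isotopy invariance forces `g` to fix every label, and two of them, the cusps `∞` and `0`,
already determine that `g = 1`. -/
lemma eq_one_of_labelAction {P : Set Surface} {rel : Prop} {φ : rigidHomeo P} {g : PSL(2, ℤ)}
    (h : (φ, g) ∈ labelAction P) (hφ : IsotopicToId P rel φ.1) : g = 1 := by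
  have key (v : Vertex) (k : Fin 3) : g • label v k = label v k := by
    have hne : ∃ u, u ∈ side k := by
      -- The witness is a corner of the hexagon, an endpoint of the side `k`.
      refine ⟨⟨fun j => if j = k + 1 then 0 else 1, fun j => ?_, ?_⟩, ?_, ?_⟩
      · dsimp only; split_ifs <;> norm_num
      · fin_cases k <;> simp
      · simp
      · simp
    obtain ⟨u, hu⟩ := hne
    have hb : pt v u ∈ bdry := mem_bdry hu
    have hl : label v k ∈ labels (pt v u) := ⟨k, hu, rfl⟩
    exact labels_subsingleton _ (h _ hb _ hl) (hφ.mem_labels hb hl)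
  -- The side `1` of each of the two hexagons at the central edge has as label the coset of its
  -- frame, namely of `1` and of `S`.
  have h1 := key (false, []) 1
  have h2 := key (true, []) 1
  rw [show (1 : Fin 3) = 0 + 1 from rfl, label_add_one] at h1 h2
  have h1' : (QuotientGroup.mk (g * 1) : Label) = QuotientGroup.mk 1 := by
    simpa [frame] using h1
  have h2' : (QuotientGroup.mk (g * modularS) : Label) = QuotientGroup.mk modularS := by
    simpa [frame] using h2
  refine eq_one_of_mem_parabolic ?_ ?_
  · simpa using QuotientGroup.eq.1 h1'.symm
  · exact QuotientGroup.eq.1 h2'.symm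

/-! ### The action of the modular group -/

lemma alphaRigid_sq_apply (x : Surface) : (alphaRigid ^ 2).1 x = halfTurn x := by
  rw [pow_two]; exact alphaFun_alphaFun x

lemma alphaRigid_sq_sq : (alphaRigid ^ 2) ^ 2 = 1 := by
  rw [← pow_mul]
  exact Subtype.ext (Homeomorph.ext alphaFun_pow_four)

lemma betaRigid_pow_three : betaRigid ^ 3 = 1 :=
  Subtype.ext (Homeomorph.ext betaFun_pow_three)

/-- The action of the modular group on the punctured ribbon tree. -/
def modularAction : PSL(2, ℤ) →* rigidHomeo punctures :=
  (modularLift (alphaRigid ^ 2) betaRigid alphaRigid_sq_sq betaRigid_pow_three).comp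
    modularEquiv.symm.toMonoidHom

lemma modularAction_S : modularAction modularS = alphaRigid ^ 2 := by
  rw [← modularEquiv_inl]; simp [modularAction, modularLift_inl]

lemma modularAction_U : modularAction modularU = betaRigid := by
  rw [← modularEquiv_inr]; simp [modularAction, modularLift_inr]

/-- The pairs compatible with the labels form a subgroup, so it suffices to check the generators `S`
and `U`. -/
lemma modularAction_mem (g : PSL(2, ℤ)) : (modularAction g, g) ∈ labelAction punctures := by
  have h : (modularAction.prod (MonoidHom.id _)).range ≤ labelAction punctures := by
    rw [MonoidHom.range_eq_map, ← closure_modular, MonoidHom.map_closure, Subgroup.closure_le,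
      Set.image_pair]
    rintro _ (rfl | rfl) x _ ℓ hℓ
    · change modularS • ℓ ∈ labels ((modularAction modularS).1 x)
      rw [modularAction_S, alphaRigid_sq_apply]
      exact mem_labels_halfTurn hℓ
    · change modularU • ℓ ∈ labels ((modularAction modularU).1 x)
      rw [modularAction_U]
      exact mem_labels_betaFun hℓ
  exact h ⟨g, rfl⟩

/-- The homomorphism from the modular group to the braided Ptolemy-Thompson group. -/
def modularToTStar (rel : Prop) : PSL(2, ℤ) →* TStar rel :=
  (QuotientGroup.mk' (isotopyTrivial punctures rel)).comp modularAction

lemma modularToTStar_S (rel : Prop) : modularToTStar rel modularS = alphaStar rel ^ 2 := by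
  rw [modularToTStar, MonoidHom.comp_apply, modularAction_S]; rfl

lemma modularToTStar_U (rel : Prop) : modularToTStar rel modularU = betaStar rel := by
  rw [modularToTStar, MonoidHom.comp_apply, modularAction_U]; rfl

lemma forget_comp_modularToTStar_injective (rel : Prop) :
    Function.Injective ((forget rel).comp (modularToTStar rel)) := by
  rw [injective_iff_map_eq_one]
  intro g hg
  have h : IsotopicToId ∅ False (modularAction g).1 := (QuotientGroup.eq_one_iff _).1 hg
  -- Compatibility with the labels does not involve the marked points, so it persists after the
  -- punctures are forgotten.
  exact eq_one_of_labelAction (P := ∅)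
    (φ := Subgroup.inclusion (rigidHomeo_le punctures) (modularAction g)) (modularAction_mem g) h

lemma range_eq_closure_modular {G : Type*} [Group G] (p : PSL(2, ℤ) →* G) :
    p.range = Subgroup.closure {p modularS, p modularU} := by
  rw [MonoidHom.range_eq_map, ← closure_modular, MonoidHom.map_closure, Set.image_pair]

end RibbonTree

end

/-! ### The main theorem -/

theorem mainTheorem7 (rel : Prop) :
    orderOf (RibbonTree.alphaStar rel ^ 2) = 2 ∧ orderOf (RibbonTree.betaStar rel) = 3 ∧
    Set.BijOn (RibbonTree.forget rel)
      (Subgroup.closure {RibbonTree.alphaStar rel ^ 2, RibbonTree.betaStar rel})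
      (Subgroup.closure {RibbonTree.alphaT ^ 2, RibbonTree.betaT}) ∧
    ∃ (f : Monoid.Coprod (Multiplicative (ZMod 2)) (Multiplicative (ZMod 3)) ≃* PSL(2, ℤ))
      (i : PSL(2, ℤ) →* RibbonTree.T) (s : PSL(2, ℤ) →* RibbonTree.TStar rel),
      f (Monoid.Coprod.inl (Multiplicative.ofAdd 1)) = RibbonTree.modularS ∧
      f (Monoid.Coprod.inr (Multiplicative.ofAdd 1)) = RibbonTree.modularU ∧
      i RibbonTree.modularS = RibbonTree.alphaT ^ 2 ∧
      i RibbonTree.modularU = RibbonTree.betaT ∧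
      Function.Injective i ∧
      i.range = Subgroup.closure {RibbonTree.alphaT ^ 2, RibbonTree.betaT} ∧
      s RibbonTree.modularS = RibbonTree.alphaStar rel ^ 2 ∧
      s RibbonTree.modularU = RibbonTree.betaStar rel ∧
      Function.Injective s ∧
      s.range = Subgroup.closure {RibbonTree.alphaStar rel ^ 2, RibbonTree.betaStar rel} ∧
      (RibbonTree.forget rel).comp s = i := by
  have hi := RibbonTree.forget_comp_modularToTStar_injective rel
  have hs : Function.Injective (RibbonTree.modularToTStar rel) :=
    Function.Injective.of_comp (f := RibbonTree.forget rel) hi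
  have sS := RibbonTree.modularToTStar_S rel
  have sU := RibbonTree.modularToTStar_U rel
  have iS : ((RibbonTree.forget rel).comp (RibbonTree.modularToTStar rel)) RibbonTree.modularS =
      RibbonTree.alphaT ^ 2 := by
    rw [MonoidHom.comp_apply, sS]; rfl
  have iU : ((RibbonTree.forget rel).comp (RibbonTree.modularToTStar rel)) RibbonTree.modularU =
      RibbonTree.betaT := by
    rw [MonoidHom.comp_apply, sU]; rfl
  have hsr := RibbonTree.range_eq_closure_modular (RibbonTree.modularToTStar rel)
  have hir := RibbonTree.range_eq_closure_modular
    ((RibbonTree.forget rel).comp (RibbonTree.modularToTStar rel))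
  rw [sS, sU] at hsr
  rw [iS, iU] at hir
  refine ⟨?_, ?_, ?_, RibbonTree.modularEquiv,
    (RibbonTree.forget rel).comp (RibbonTree.modularToTStar rel), RibbonTree.modularToTStar rel,
    RibbonTree.modularEquiv_inl, RibbonTree.modularEquiv_inr, iS, iU, hi, hir, sS, sU, hs, hsr, rfl⟩
  · rw [← sS, orderOf_injective _ hs]
    exact orderOf_eq_prime RibbonTree.modularS_sq RibbonTree.modularS_ne_one
  · rw [← sU, orderOf_injective _ hs]
    exact orderOf_eq_prime RibbonTree.modularU_pow_three RibbonTree.modularU_ne_one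
  -- Both subgroups are images of `PSL(2, ℤ)`, under `s` and under `i`; injectivity of the forgetful
  -- map on the first follows from injectivity of the composition.
  · rw [← hsr, ← hir, MonoidHom.coe_range, MonoidHom.coe_range]
    refine ⟨?_, ?_, ?_⟩
    · rintro _ ⟨g, rfl⟩
      exact ⟨g, rfl⟩
    · rintro _ ⟨g, rfl⟩ _ ⟨h, rfl⟩ hgh
      exact congrArg _ (hi hgh)
    · rintro _ ⟨g, rfl⟩
      exact ⟨_, ⟨g, rfl⟩, rfl⟩
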